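/- All spaces are complex. A *normed algebra* $A$ is a unital algebra with a norm satisfying $\|ab\|\le\|a\|\|b\|$ and $\|1\|\le 1$; a *normed $A$-module* is a normed space with a unital left $A$-module structure satisfying $\|a\cdot x\|\le\|a\|\|x\|$; *Banach* means complete. An operator between normed spaces is *coisometric* if it maps the open unit ball onto the open unit ball. A normed (resp. Banach) $A$-module $P$ is *extremely projective* if for every coisometric morphism $\tau:Y\to X$ of normed (resp. Banach) $A$-modules, every bounded morphism $\varphi:P\to X$ and every $\varepsilon>0$ there is a bounded morphism $\psi:P\to Y$ with $\tau\psi=\varphi$ and $\|\psi\|<\|\varphi\|+\varepsilon$. A module $V$ is a *near-retract* of a module $U$ if there is a contractive morphism $\sigma:U\to V$ that has, for every $\varepsilon>0$, a right inverse morphism $\zeta$ with $\|\zeta\|<1+\varepsilon$. Here $l_1^0(M)\subset l_1(M)$ is the normed subspace of finitely supported functions, and $\otimes_p$, $\widehat\otimes$ are the non-completed and the completed projective tensor products. A *quantum space* is a linear space $E$ with norms on all matrix spaces $M_n(E)$ satisfying Ruan's axioms ($\|v\oplus w\|=\max(\|v\|,\|w\|)$ and $\|\alpha v\beta\|\le\|\alpha\|\|v\|\|\beta\|$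 for scalar matrices $\alpha,\beta$); it is complete if $E=M_1(E)$ is. An operator is completely contractive (resp. completely coisometric) if all its amplifications $\varphi_n:M_n(E)\to M_n(F)$ are contractive (resp. coisometric), and $\|\varphi\|_{cb}=\sup_n\|\varphi_n\|$. A quantum space (resp. complete quantum space) $P$ is *extremely projective* if for every completely coisometric operator $\tau:G\to E$ of quantum spaces (resp. complete quantum spaces), every completely bounded $\varphi:P\to E$ and every $\varepsilon>0$ there is a completely bounded $\psi:P\to G$ with $\tau\psi=\varphi$ and $\|\psi\|_{cb}<\|\varphi\|_{cb}+\varepsilon$. $V$ is a *near-retract* of $U$ if there is a completely contractive operator $\sigma:U\to V$ that has, for every $\varepsilon>0$, a completely bounded right inverse $\zeta$ with $\|\zeta\|_{cb}<1+\varepsilon$. $\mathbf{QNor}_1$ (resp. $\mathbf{QBan}_1$) is the category of quantum spaces (resp. complete quantum spaces) and completely contractive operators, and $\mathcal N_n$ ($n\ge1$) is the space of trace class operators on $\mathbb C^n$ with the quantum norm of the quantum dual of $\mathcal B(\mathbb C^n)$ under the pairing $(b,a)\mapsto\mathrm{tr}(ba)$. **Corollary 6.13.** (i) A normed module $P$ over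 a normed algebra $A$ is extremely projective if and only if it is a near-retract of $A\otimes_p l_1^0(M)$ for some set $M$. A Banach module $P$ over a Banach algebra $A$ is extremely projective if and only if it is a near-retract of $A\widehat\otimes l_1(M)$ for some set $M$. (ii) A quantum space $P$ is extremely projective if and only if it is a near-retract of a coproduct in $\mathbf{QNor}_1$ of some family of spaces $\mathcal N_n$, $n\in\mathbb N$. A complete quantum space $P$ is extremely projective if and only if it is a near-retract of a coproduct in $\mathbf{QBan}_1$ of some family of spaces $\mathcal N_n$, $n\in\mathbb N$. -/

import Mathlib

open scoped TensorProduct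

universe u

/-! ## Normed modules, morphisms, extreme projectivity -/

section NormedModules

/-- A linear operator between normed spaces is *coisometric* if it maps the open unit ball of the
domain onto the open unit ball of the codomain. -/
def IsCoisometric {E F : Type*} [NormedAddCommGroup E] [NormedAddCommGroup F] (τ : E → F) : Prop :=
  τ '' Metric.ball 0 1 = Metric.ball 0 1

/-- The operator norm of a bounded morphism of normed modules over a normed algebra, i.e. its norm
as a bounded operator between the underlying complex normed spaces. -/
noncomputable def morphismNorm {A X Y : Type*} [NormedRing A] [NormedAlgebra ℂ A]
    [NormedAddCommGroup X] [NormedSpace ℂ X] [Module A X] [IsScalarTower ℂ A X]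
    [NormedAddCommGroup Y] [NormedSpace ℂ Y] [Module A Y] [IsScalarTower ℂ A Y]
    (φ : X →L[A] Y) : ℝ :=
  ‖φ.restrictScalars ℂ‖

/-- Extreme projectivity of a normed left `A`-module `P`, tested on all (contractive, unital,
not necessarily complete) normed left `A`-modules. -/
def IsExtremelyProjective (A P : Type u) [NormedRing A] [NormedAlgebra ℂ A]
    [NormedAddCommGroup P] [NormedSpace ℂ P] [Module A P] [IsScalarTower ℂ A P] : Prop :=
  ∀ (Y X : Type u)
    [NormedAddCommGroup Y] [NormedSpace ℂ Y] [Module A Y] [IsScalarTower ℂ A Y] [IsBoundedSMul A Y]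
    [NormedAddCommGroup X] [NormedSpace ℂ X] [Module A X] [IsScalarTower ℂ A X] [IsBoundedSMul A X]
    (τ : Y →L[A] X), IsCoisometric τ → ∀ (φ : P →L[A] X) (ε : ℝ), 0 < ε →
      ∃ ψ : P →L[A] Y, τ.comp ψ = φ ∧ morphismNorm ψ < morphismNorm φ + ε

/-- Extreme projectivity of a Banach left `A`-module `P`, tested on all Banach left `A`-modules. -/
def IsBanachExtremelyProjective (A P : Type u) [NormedRing A] [NormedAlgebra ℂ A]
    [NormedAddCommGroup P] [NormedSpace ℂ P] [Module A P] [IsScalarTower ℂ A P] : Prop :=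
  ∀ (Y X : Type u)
    [NormedAddCommGroup Y] [NormedSpace ℂ Y] [Module A Y] [IsScalarTower ℂ A Y] [IsBoundedSMul A Y]
    [CompleteSpace Y]
    [NormedAddCommGroup X] [NormedSpace ℂ X] [Module A X] [IsScalarTower ℂ A X] [IsBoundedSMul A X]
    [CompleteSpace X]
    (τ : Y →L[A] X), IsCoisometric τ → ∀ (φ : P →L[A] X) (ε : ℝ), 0 < ε →
      ∃ ψ : P →L[A] Y, τ.comp ψ = φ ∧ morphismNorm ψ < morphismNorm φ + ε

/-- `V` is a *near-retract* of `U`: there is a near-retraction `σ : U → V`, that is, a contractive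
module morphism which for every `ε > 0` has a right inverse module morphism of norm `< 1 + ε`. -/
def IsNearRetract (A : Type*) [NormedRing A] [NormedAlgebra ℂ A] (V U : Type*)
    [NormedAddCommGroup V] [NormedSpace ℂ V] [Module A V] [IsScalarTower ℂ A V]
    [NormedAddCommGroup U] [NormedSpace ℂ U] [Module A U] [IsScalarTower ℂ A U] : Prop :=
  ∃ σ : U →L[A] V, morphismNorm σ ≤ 1 ∧ ∀ ε : ℝ, 0 < ε →
    ∃ ζ : V →L[A] U, σ.comp ζ = ContinuousLinearMap.id A V ∧ morphismNorm ζ < 1 + ε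

end NormedModules

/-! ## The projective tensor product and the spaces `l₁⁰(M)`, `l₁(M)` -/

section ProjectiveTensor

/-- The projective norm of `t ∈ X ⊗ E`: the infimum of `∑ ‖xᵢ‖ ‖eᵢ‖` over all representations
`t = ∑ xᵢ ⊗ eᵢ`. -/
noncomputable def projNorm {X E : Type*} [NormedAddCommGroup X] [NormedSpace ℂ X]
    [NormedAddCommGroup E] [NormedSpace ℂ E] (t : X ⊗[ℂ] E) : ℝ :=
  sInf {r : ℝ | ∃ s : List (X × E), (s.map fun p => p.1 ⊗ₜ[ℂ] p.2).sum = t ∧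
    (s.map fun p => ‖p.1‖ * ‖p.2‖).sum = r}

/-- The non-completed projective tensor product `X ⊗ₚ E`: the algebraic tensor product,
endowed below with the projective norm. -/
def ProjTensor (X E : Type*) [NormedAddCommGroup X] [NormedSpace ℂ X]
    [NormedAddCommGroup E] [NormedSpace ℂ E] : Type _ :=
  X ⊗[ℂ] E

namespace ProjTensor

theorem sum_nonneg {X E : Type*} [NormedAddCommGroup X] [NormedAddCommGroup E]
    (s : List (X × E)) :
    0 ≤ (s.map fun p => ‖p.1‖ * ‖p.2‖).sum := by
  apply List.sum_nonneg
  intro x hx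
  obtain ⟨p, -, rfl⟩ := List.mem_map.1 hx
  positivity

section Norm

variable {X E : Type*} [NormedAddCommGroup X] [NormedSpace ℂ X]
  [NormedAddCommGroup E] [NormedSpace ℂ E]

theorem exists_rep (t : X ⊗[ℂ] E) :
    ∃ s : List (X × E), (s.map fun p => p.1 ⊗ₜ[ℂ] p.2).sum = t := by
  induction t using TensorProduct.induction_on with
  | zero => exact ⟨[], by simp⟩
  | tmul x y => exact ⟨[(x, y)], by simp⟩
  | add x y hx hy =>
    obtain ⟨s, rfl⟩ := hx
    obtain ⟨s', rfl⟩ := hy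
    exact ⟨s ++ s', by simp⟩

theorem projNorm_nonneg (t : X ⊗[ℂ] E) : 0 ≤ projNorm t := by
  apply Real.sInf_nonneg
  rintro r ⟨s, -, rfl⟩
  exact sum_nonneg s

theorem projNorm_le (s : List (X × E)) :
    projNorm (s.map fun p => p.1 ⊗ₜ[ℂ] p.2).sum ≤ (s.map fun p => ‖p.1‖ * ‖p.2‖).sum := by
  refine csInf_le ⟨0, ?_⟩ ⟨s, rfl, rfl⟩
  rintro r ⟨s, -, rfl⟩
  exact sum_nonneg s

theorem exists_lt {t : X ⊗[ℂ] E} {c : ℝ} (h : projNorm t < c) :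
    ∃ s : List (X × E), (s.map fun p => p.1 ⊗ₜ[ℂ] p.2).sum = t ∧
      (s.map fun p => ‖p.1‖ * ‖p.2‖).sum < c := by
  obtain ⟨s, hs⟩ := exists_rep t
  obtain ⟨r, ⟨s, hs, rfl⟩, hr⟩ := exists_lt_of_csInf_lt (by exact ⟨_, s, hs, rfl⟩) h
  exact ⟨s, hs, hr⟩

theorem projNorm_add_le (t t' : X ⊗[ℂ] E) : projNorm (t + t') ≤ projNorm t + projNorm t' := by
  refine le_of_forall_pos_le_add fun ε hε => ?_
  obtain ⟨s, rfl, hs⟩ := exists_lt (lt_add_of_pos_right (projNorm t) (half_pos hε))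
  obtain ⟨s', rfl, hs'⟩ := exists_lt (lt_add_of_pos_right (projNorm t') (half_pos hε))
  have := projNorm_le (s ++ s')
  simp only [List.map_append, List.sum_append] at this
  linarith

theorem projNorm_map_le (f : X →ₗ[ℂ] X) (c : ℝ) (hc : 0 ≤ c) (hf : ∀ x, ‖f x‖ ≤ c * ‖x‖)
    (t : X ⊗[ℂ] E) : projNorm (f.rTensor E t) ≤ c * projNorm t := by
  refine le_of_forall_pos_le_add fun ε hε => ?_
  obtain ⟨s, rfl, hs⟩ := exists_lt
    (lt_add_of_pos_right (projNorm t) (show 0 < ε / (c + 1) by positivity))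
  have h1 := projNorm_le (s.map fun p => (f p.1, p.2))
  have h2 : (((s.map fun p => (f p.1, p.2))).map fun p => p.1 ⊗ₜ[ℂ] p.2).sum =
      f.rTensor E (s.map fun p => p.1 ⊗ₜ[ℂ] p.2).sum := by
    rw [map_list_sum, List.map_map, List.map_map]
    rfl
  have h3 : (((s.map fun p => (f p.1, p.2))).map fun p => ‖p.1‖ * ‖p.2‖).sum ≤
      c * (s.map fun p => ‖p.1‖ * ‖p.2‖).sum := by
    rw [List.map_map, ← List.sum_map_mul_left]
    apply List.sum_le_sum
    intro p _
    have := mul_le_mul_of_nonneg_right (hf p.1) (norm_nonneg p.2)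
    simp only [Function.comp]
    linarith
  rw [h2] at h1
  have h4 := mul_le_mul_of_nonneg_left hs.le hc
  have h5 : c * (ε / (c + 1)) ≤ ε := by
    rw [mul_div_assoc', div_le_iff₀ (by positivity)]
    nlinarith
  linarith

theorem projNorm_smul (c : ℂ) (t : X ⊗[ℂ] E) : projNorm (c • t) = ‖c‖ * projNorm t := by
  have key : ∀ (c : ℂ) (t : X ⊗[ℂ] E), projNorm (c • t) ≤ ‖c‖ * projNorm t := by
    intro c t
    have := projNorm_map_le (c • LinearMap.id) ‖c‖ (norm_nonneg c)
      (fun x => (norm_smul c x).le) t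
    simpa using this
  refine le_antisymm (key c t) ?_
  rcases eq_or_ne c 0 with rfl | hc
  · simpa using projNorm_nonneg _
  · have := key c⁻¹ (c • t)
    rw [smul_smul, inv_mul_cancel₀ hc, one_smul, norm_inv] at this
    rwa [le_inv_mul_iff₀ (norm_pos_iff.2 hc)] at this

theorem norm_dual_le (f : X →L[ℂ] ℂ) (g : E →L[ℂ] ℂ) (t : X ⊗[ℂ] E) :
    ‖TensorProduct.lift ((LinearMap.mul ℂ ℂ).compl₁₂ f.toLinearMap g.toLinearMap) t‖ ≤
      ‖f‖ * ‖g‖ * projNorm t := by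
  refine le_of_forall_pos_le_add fun ε hε => ?_
  set c := ‖f‖ * ‖g‖ with hc
  have hc0 : 0 ≤ c := by positivity
  obtain ⟨s, rfl, hs⟩ := exists_lt
    (lt_add_of_pos_right (projNorm t) (show 0 < ε / (c + 1) by positivity))
  have h3 : ‖TensorProduct.lift ((LinearMap.mul ℂ ℂ).compl₁₂ f.toLinearMap g.toLinearMap)
      (s.map fun p => p.1 ⊗ₜ[ℂ] p.2).sum‖ ≤ c * (s.map fun p => ‖p.1‖ * ‖p.2‖).sum := by
    clear hs
    induction s with
    | nil => simp
    | cons p s ih =>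
      simp only [List.map_cons, List.sum_cons, map_add]
      refine (norm_add_le _ _).trans ?_
      have h : ‖TensorProduct.lift ((LinearMap.mul ℂ ℂ).compl₁₂ f.toLinearMap g.toLinearMap)
          (p.1 ⊗ₜ[ℂ] p.2)‖ ≤ c * (‖p.1‖ * ‖p.2‖) := by
        simp only [TensorProduct.lift.tmul, LinearMap.compl₁₂_apply, LinearMap.mul_apply',
          norm_mul]
        calc _ ≤ (‖f‖ * ‖p.1‖) * (‖g‖ * ‖p.2‖) :=
              mul_le_mul (f.le_opNorm _) (g.le_opNorm _) (norm_nonneg _) (by positivity)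
          _ = _ := by rw [hc]; ring
      linarith
  have h4 := mul_le_mul_of_nonneg_left hs.le hc0
  have h5 : c * (ε / (c + 1)) ≤ ε := by
    rw [mul_div_assoc', div_le_iff₀ (by positivity)]
    nlinarith
  linarith

theorem eq_zero_of_projNorm (t : X ⊗[ℂ] E) (h : projNorm t = 0) : t = 0 := by
  obtain ⟨M, hM, hs⟩ := TensorProduct.exists_finite_submodule_left_of_setFinite {t}
    (Set.finite_singleton t)
  obtain ⟨t', rfl⟩ := hs (Set.mem_singleton t)
  let b := Module.finBasis ℂ M
  suffices ht : t' = 0 by simp [ht]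
  apply (TensorProduct.equivFinsuppOfBasisLeft (N := E) b).injective
  rw [map_zero]
  ext i
  by_contra hne
  obtain ⟨f, hf, -⟩ := exists_extension_norm_eq M (b.coord i).toContinuousLinearMap
  obtain ⟨g, -, hg⟩ := exists_dual_vector ℂ
    (TensorProduct.equivFinsuppOfBasisLeft b t' i) (norm_ne_zero_iff.2 hne)
  have h1 := norm_dual_le f g (M.subtype.rTensor E t')
  have h2 : ∀ z : M ⊗[ℂ] E,
      TensorProduct.lift ((LinearMap.mul ℂ ℂ).compl₁₂ f.toLinearMap g.toLinearMap)
        (M.subtype.rTensor E z) = g (TensorProduct.equivFinsuppOfBasisLeft b z i) := by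
    intro z
    induction z using TensorProduct.induction_on with
    | zero => simp
    | tmul x y =>
      have := hf x
      simp only [LinearMap.coe_toContinuousLinearMap'] at this
      simp [this]
    | add x y hx hy => simp only [map_add, hx, hy, Finsupp.add_apply]
  rw [h2, hg, h, mul_zero] at h1
  have h3 : ‖TensorProduct.equivFinsuppOfBasisLeft b t' i‖ ≤ 0 := by simpa using h1
  exact hne (norm_le_zero_iff.1 h3)

noncomputable instance : AddCommGroup (ProjTensor X E) := inferInstanceAs (AddCommGroup (X ⊗[ℂ] E))

noncomputable instance : Module ℂ (ProjTensor X E) := inferInstanceAs (Module ℂ (X ⊗[ℂ] E))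

noncomputable instance : Norm (ProjTensor X E) := ⟨fun t => projNorm (X := X) (E := E) t⟩

theorem core : NormedSpace.Core ℂ (ProjTensor X E) where
  norm_nonneg t := projNorm_nonneg (X := X) (E := E) t
  norm_smul c t := projNorm_smul (X := X) (E := E) c t
  norm_triangle t t' := projNorm_add_le (X := X) (E := E) t t'
  norm_eq_zero_iff t := by
    refine ⟨eq_zero_of_projNorm (X := X) (E := E) t, ?_⟩
    rintro rfl
    have := projNorm_smul (X := X) (E := E) 0 0
    rwa [zero_smul, norm_zero, zero_mul] at this

noncomputable instance : NormedAddCommGroup (ProjTensor X E) := NormedAddCommGroup.ofCore core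

noncomputable instance : NormedSpace ℂ (ProjTensor X E) := NormedSpace.ofCore core

end Norm

section Module

variable {A E : Type*} [NormedRing A] [NormedAlgebra ℂ A]
  [NormedAddCommGroup E] [NormedSpace ℂ E]

/-- The outer multiplication `a • (b ⊗ x) = ab ⊗ x` on `A ⊗ₚ E`. -/
noncomputable instance : Module A (ProjTensor A E) := inferInstanceAs (Module A (A ⊗[ℂ] E))

instance : IsScalarTower ℂ A (ProjTensor A E) := inferInstanceAs (IsScalarTower ℂ A (A ⊗[ℂ] E))

instance : IsBoundedSMul A (ProjTensor A E) := by
  refine IsBoundedSMul.of_norm_smul_le fun a t => ?_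
  have h := projNorm_map_le (E := E) (LinearMap.mulLeft ℂ a) ‖a‖ (norm_nonneg a)
    (fun x => norm_mul_le a x) t
  have h2 : ∀ z : A ⊗[ℂ] E, (LinearMap.mulLeft ℂ a).rTensor E z = a • z := by
    intro z
    induction z using TensorProduct.induction_on with
    | zero => simp
    | tmul x y => simp [TensorProduct.smul_tmul']
    | add x y hx hy => simp only [map_add, smul_add, hx, hy]
  exact (congrArg projNorm (h2 t)).symm.trans_le h

end Module

end ProjTensor

/-- The completed projective tensor product `X ⊗̂ E`. If `X = A` is a normed algebra, it carries the
`A`-module structure extended by continuity from `A ⊗ₚ E`. -/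
abbrev CompletedProjTensor (X E : Type*) [NormedAddCommGroup X] [NormedSpace ℂ X]
    [NormedAddCommGroup E] [NormedSpace ℂ E] : Type _ :=
  UniformSpace.Completion (ProjTensor X E)

/-- The Banach space `l₁(M)` of absolutely summable complex families. -/
abbrev L1 (M : Type*) : Type _ := lp (fun _ : M => ℂ) 1

/-- The subspace of `l₁(M)` of finitely supported families. -/
def finSupp (M : Type*) : Submodule ℂ (L1 M) where
  carrier := {f | (Function.support (f : M → ℂ)).Finite}
  zero_mem' := by simp [Function.support]
  add_mem' {f g} hf hg := (hf.union hg).subset (Function.support_add (f : M → ℂ) (g : M → ℂ))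
  smul_mem' c f hf := hf.subset (Function.support_const_smul_subset c (f : M → ℂ))

/-- The normed space `l₁⁰(M)` of finitely supported families with the `l₁`-norm. -/
abbrev L1Zero (M : Type*) : Type _ := finSupp M

end ProjectiveTensor

/-! ## Quantum spaces (abstract operator spaces) -/

section Quantum

open scoped Matrix.Norms.L2Operator

/-- A quantum space: a linear space `E` with norms on all matrix spaces `M_n(E)` that satisfy the
axioms of Ruan. The norm of `E` is the norm of `M_1(E)`. Scalar matrices carry the operator norm
between Euclidean spaces. -/
class QuantumSpace (E : Type*) [NormedAddCommGroup E] [NormedSpace ℂ E] where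
  /-- the norm of `M_n(E)` -/
  mnorm : (n : ℕ) → Matrix (Fin n) (Fin n) E → ℝ
  mnorm_add_le : ∀ (n : ℕ) (v w : Matrix (Fin n) (Fin n) E),
    mnorm n (v + w) ≤ mnorm n v + mnorm n w
  mnorm_smul : ∀ (n : ℕ) (c : ℂ) (v : Matrix (Fin n) (Fin n) E), mnorm n (c • v) = ‖c‖ * mnorm n v
  eq_zero_of_mnorm_eq_zero : ∀ (n : ℕ) (v : Matrix (Fin n) (Fin n) E), mnorm n v = 0 → v = 0
  mnorm_one : ∀ v : Matrix (Fin 1) (Fin 1) E, mnorm 1 v = ‖v 0 0‖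
  /-- `‖v ⊕ w‖ = max (‖v‖, ‖w‖)` -/
  mnorm_directSum : ∀ (m n : ℕ) (v : Matrix (Fin m) (Fin m) E) (w : Matrix (Fin n) (Fin n) E),
    mnorm (m + n) ((Matrix.fromBlocks v 0 0 w).submatrix finSumFinEquiv.symm finSumFinEquiv.symm) =
      max (mnorm m v) (mnorm n w)
  /-- `‖α v β‖ ≤ ‖α‖ ‖v‖ ‖β‖` -/
  mnorm_mul_mul_le : ∀ (m n : ℕ) (α : Matrix (Fin n) (Fin m) ℂ) (v : Matrix (Fin m) (Fin m) E)
    (β : Matrix (Fin m) (Fin n) ℂ),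
    mnorm n (Matrix.of fun i j => ∑ k, ∑ l, (α i k * β l j) • v k l) ≤ ‖α‖ * mnorm m v * ‖β‖

open QuantumSpace (mnorm)

section Operators

variable {E F : Type*} [NormedAddCommGroup E] [NormedSpace ℂ E] [QuantumSpace E]
  [NormedAddCommGroup F] [NormedSpace ℂ F] [QuantumSpace F]

/-- An operator is completely bounded if its amplifications are uniformly bounded. -/
def IsCompletelyBounded (φ : E →ₗ[ℂ] F) : Prop :=
  ∃ C : ℝ, ∀ (n : ℕ) (v : Matrix (Fin n) (Fin n) E), mnorm n (v.map φ) ≤ C * mnorm n v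

/-- The completely bounded norm: the supremum of the operator norms of all amplifications. -/
noncomputable def cbNorm (φ : E →ₗ[ℂ] F) : ℝ :=
  sSup {r : ℝ | ∃ (n : ℕ) (v : Matrix (Fin n) (Fin n) E), mnorm n v ≤ 1 ∧ mnorm n (v.map φ) = r}

/-- An operator is completely contractive if all its amplifications are contractive. -/
def IsCompletelyContractive (φ : E →ₗ[ℂ] F) : Prop :=
  ∀ (n : ℕ) (v : Matrix (Fin n) (Fin n) E), mnorm n (v.map φ) ≤ mnorm n v

/-- An operator is completely coisometric if all its amplifications map the open unit ball onto the
open unit ball. -/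
def IsCompletelyCoisometric (τ : E →ₗ[ℂ] F) : Prop :=
  ∀ n : ℕ, (fun v : Matrix (Fin n) (Fin n) E => v.map τ) '' {v | mnorm n v < 1} =
    {w : Matrix (Fin n) (Fin n) F | mnorm n w < 1}

end Operators

/-- Extreme projectivity of a quantum space, tested on all (not necessarily complete) quantum
spaces. -/
def IsQuantumExtremelyProjective (P : Type u) [NormedAddCommGroup P] [NormedSpace ℂ P]
    [QuantumSpace P] : Prop :=
  ∀ (G E : Type u)
    [NormedAddCommGroup G] [NormedSpace ℂ G] [QuantumSpace G]
    [NormedAddCommGroup E] [NormedSpace ℂ E] [QuantumSpace E]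
    (τ : G →ₗ[ℂ] E), IsCompletelyCoisometric τ →
      ∀ φ : P →ₗ[ℂ] E, IsCompletelyBounded φ → ∀ ε : ℝ, 0 < ε →
        ∃ ψ : P →ₗ[ℂ] G, IsCompletelyBounded ψ ∧ τ ∘ₗ ψ = φ ∧ cbNorm ψ < cbNorm φ + ε

/-- Extreme projectivity of a complete quantum space, tested on all complete quantum spaces. -/
def IsCompleteQuantumExtremelyProjective (P : Type u) [NormedAddCommGroup P] [NormedSpace ℂ P]
    [QuantumSpace P] : Prop :=
  ∀ (G E : Type u)
    [NormedAddCommGroup G] [NormedSpace ℂ G] [QuantumSpace G] [CompleteSpace G]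
    [NormedAddCommGroup E] [NormedSpace ℂ E] [QuantumSpace E] [CompleteSpace E]
    (τ : G →ₗ[ℂ] E), IsCompletelyCoisometric τ →
      ∀ φ : P →ₗ[ℂ] E, IsCompletelyBounded φ → ∀ ε : ℝ, 0 < ε →
        ∃ ψ : P →ₗ[ℂ] G, IsCompletelyBounded ψ ∧ τ ∘ₗ ψ = φ ∧ cbNorm ψ < cbNorm φ + ε

/-- `V` is a near-retract of `U` in the sense of quantum spaces: there is a completely contractive
operator `σ : U → V` which for every `ε > 0` has a completely bounded right inverse of completely
bounded norm `< 1 + ε`. -/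
def IsQuantumNearRetract (V U : Type*) [NormedAddCommGroup V] [NormedSpace ℂ V] [QuantumSpace V]
    [NormedAddCommGroup U] [NormedSpace ℂ U] [QuantumSpace U] : Prop :=
  ∃ σ : U →ₗ[ℂ] V, IsCompletelyContractive σ ∧ ∀ ε : ℝ, 0 < ε →
    ∃ ζ : V →ₗ[ℂ] U, IsCompletelyBounded ζ ∧ σ ∘ₗ ζ = LinearMap.id ∧ cbNorm ζ < 1 + ε

/-! ### The spaces `𝒩_n` -/

/-- The space `𝒩_n` of (trace class) operators on `ℂⁿ`. Its norm and quantum norm, defined below,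
are those of the quantum dual of `ℬ(ℂⁿ)` under the pairing `(b, a) ↦ tr (b a)`. -/
def NuclearSpace (n : ℕ) : Type u := ULift.{u} (Matrix (Fin n) (Fin n) ℂ)

namespace NuclearSpace

section MatrixNorms

variable {k l m n : Type*} [Fintype k] [Fintype l] [Fintype m] [Fintype n]
  [DecidableEq n]

theorem opNorm_le_of_sq (A : Matrix m n ℂ) (c : ℝ) (hc : 0 ≤ c)
    (h : ∀ x : n → ℂ, ∑ i, ‖(A.mulVec x) i‖ ^ 2 ≤ c ^ 2 * ∑ j, ‖x j‖ ^ 2) : ‖A‖ ≤ c := by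
  rw [Matrix.l2_opNorm_def]
  refine ContinuousLinearMap.opNorm_le_bound _ hc fun x => ?_
  apply le_of_sq_le_sq _ (by positivity)
  rw [mul_pow, EuclideanSpace.norm_sq_eq, EuclideanSpace.norm_sq_eq]
  exact h x.ofLp

theorem sq_mulVec_le (A : Matrix m n ℂ) (x : n → ℂ) :
    ∑ i, ‖(A.mulVec x) i‖ ^ 2 ≤ ‖A‖ ^ 2 * ∑ j, ‖x j‖ ^ 2 := by
  have h := Matrix.l2_opNorm_mulVec A (WithLp.toLp 2 x)
  have h2 := pow_le_pow_left₀ (norm_nonneg _) h 2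
  rwa [mul_pow, EuclideanSpace.norm_sq_eq, EuclideanSpace.norm_sq_eq] at h2

variable [DecidableEq l]

theorem norm_fromBlocks_le (A : Matrix m n ℂ) (D : Matrix k l ℂ) :
    ‖Matrix.fromBlocks A 0 0 D‖ ≤ max ‖A‖ ‖D‖ := by
  apply opNorm_le_of_sq _ _ (le_max_of_le_left (norm_nonneg _))
  intro x
  rw [Fintype.sum_sum_type, Fintype.sum_sum_type, mul_add]
  have h1 := sq_mulVec_le A (x ∘ Sum.inl)
  have h2 := sq_mulVec_le D (x ∘ Sum.inr)
  have e1 : ‖A‖ ^ 2 ≤ (max ‖A‖ ‖D‖) ^ 2 := pow_le_pow_left₀ (norm_nonneg _) (le_max_left _ _) 2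
  have e2 : ‖D‖ ^ 2 ≤ (max ‖A‖ ‖D‖) ^ 2 := pow_le_pow_left₀ (norm_nonneg _) (le_max_right _ _) 2
  have n1 : (0 : ℝ) ≤ ∑ j, ‖(x ∘ Sum.inl) j‖ ^ 2 := Finset.sum_nonneg fun _ _ => by positivity
  have n2 : (0 : ℝ) ≤ ∑ j, ‖(x ∘ Sum.inr) j‖ ^ 2 := Finset.sum_nonneg fun _ _ => by positivity
  simp only [Matrix.fromBlocks_mulVec, Sum.elim_inl, Sum.elim_inr, Matrix.zero_mulVec, add_zero,
    zero_add]
  exact add_le_add (h1.trans (mul_le_mul_of_nonneg_right e1 n1))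
    (h2.trans (mul_le_mul_of_nonneg_right e2 n2))

theorem norm_submatrix_le (A : Matrix m n ℂ) {f : k → m} {g : l → n} (hf : f.Injective)
    (hg : g.Injective) : ‖A.submatrix f g‖ ≤ ‖A‖ := by
  classical
  apply opNorm_le_of_sq _ _ (norm_nonneg _)
  intro x
  let y : n → ℂ := fun j => ∑ i, if g i = j then x i else 0
  have hy : ∀ i, y (g i) = x i := by
    intro i
    simp [y, hg.eq_iff]
  have hy0 : ∀ j, j ∉ Set.range g → y j = 0 := by
    intro j hj
    apply Finset.sum_eq_zero
    intro i _
    rw [if_neg]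
    exact fun h => hj ⟨i, h⟩
  have key : ∀ h : n → ℝ, (∀ j, j ∉ Set.range g → h j = 0) → ∑ i, h (g i) = ∑ j, h j := by
    intro h hh
    rw [← Finset.sum_image (s := Finset.univ) (g := g) (f := h) (fun a _ b _ e => hg e)]
    apply Finset.sum_subset (Finset.subset_univ _)
    intro j _ hj
    apply hh
    rintro ⟨i, rfl⟩
    exact hj (Finset.mem_image_of_mem _ (Finset.mem_univ _))
  have key' : ∀ h : n → ℂ, (∀ j, j ∉ Set.range g → h j = 0) → ∑ i, h (g i) = ∑ j, h j := by
    intro h hh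
    rw [← Finset.sum_image (s := Finset.univ) (g := g) (f := h) (fun a _ b _ e => hg e)]
    apply Finset.sum_subset (Finset.subset_univ _)
    intro j _ hj
    apply hh
    rintro ⟨i, rfl⟩
    exact hj (Finset.mem_image_of_mem _ (Finset.mem_univ _))
  have h1 : ∀ i, ((A.submatrix f g).mulVec x) i = (A.mulVec y) (f i) := by
    intro i
    simp only [Matrix.mulVec, dotProduct, Matrix.submatrix_apply]
    rw [← key' (fun j => A (f i) j * y j) (fun j hj => by simp [hy0 j hj])]
    simp [hy]
  have h2 : ∑ j, ‖x j‖ ^ 2 = ∑ j, ‖y j‖ ^ 2 := by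
    rw [← key (fun j => ‖y j‖ ^ 2) (fun j hj => by simp [hy0 j hj])]
    simp [hy]
  rw [h2]
  refine le_trans ?_ (sq_mulVec_le A y)
  simp only [h1]
  rw [← Finset.sum_image (s := Finset.univ) (g := f) (f := fun i => ‖(A.mulVec y) i‖ ^ 2)
    (fun a _ b _ e => hf e)]
  exact Finset.sum_le_sum_of_subset_of_nonneg (Finset.subset_univ _) fun _ _ _ => by positivity

open scoped Kronecker

theorem norm_kronecker_one_le [DecidableEq k] (A : Matrix m n ℂ) :
    ‖A ⊗ₖ (1 : Matrix k k ℂ)‖ ≤ ‖A‖ := by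
  apply opNorm_le_of_sq _ _ (norm_nonneg _)
  intro x
  have h1 : ∀ i j, ((A ⊗ₖ (1 : Matrix k k ℂ)).mulVec x) (i, j) =
      (A.mulVec fun i' => x (i', j)) i := by
    intro i j
    simp [Matrix.mulVec, dotProduct, Fintype.sum_prod_type, Matrix.one_apply]
  rw [Fintype.sum_prod_type_right, Fintype.sum_prod_type_right, Finset.mul_sum]
  apply Finset.sum_le_sum
  intro j _
  simp only [h1]
  exact sq_mulVec_le A _

theorem norm_one_kronecker_le [DecidableEq k] (A : Matrix m n ℂ) :
    ‖(1 : Matrix k k ℂ) ⊗ₖ A‖ ≤ ‖A‖ := by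
  have : (1 : Matrix k k ℂ) ⊗ₖ A =
      (A ⊗ₖ (1 : Matrix k k ℂ)).submatrix Prod.swap Prod.swap := by
    ext ⟨p, p'⟩ ⟨q, q'⟩
    simp [mul_comm]
  rw [this]
  exact (norm_submatrix_le _ Prod.swap_injective Prod.swap_injective).trans
    (norm_kronecker_one_le A)

theorem norm_kronecker_le [DecidableEq m] (A : Matrix m m ℂ) (B : Matrix n n ℂ) :
    ‖A ⊗ₖ B‖ ≤ ‖A‖ * ‖B‖ := by
  have : A ⊗ₖ B = (A ⊗ₖ (1 : Matrix n n ℂ)) * ((1 : Matrix m m ℂ) ⊗ₖ B) := by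
    rw [← Matrix.mul_kronecker_mul]
    simp
  rw [this]
  exact (Matrix.l2_opNorm_mul _ _).trans (mul_le_mul (norm_kronecker_one_le A)
    (norm_one_kronecker_le B) (norm_nonneg _) (norm_nonneg _))

end MatrixNorms

section Pairing

variable {n : ℕ}

/-- The matrix `(tr (u_{kl} a_{ij}))` with rows `(k, i)` and columns `(l, j)`, for a matrix `u` over
`𝒩_n` and a matrix `a` over `ℬ(ℂⁿ)`. -/
def pairing {m r : Type*} (u : Matrix m m (Matrix (Fin n) (Fin n) ℂ))
    (a : Matrix r r (Matrix (Fin n) (Fin n) ℂ)) : Matrix (m × r) (m × r) ℂ :=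
  Matrix.of fun p q => (u p.1 q.1 * a p.2 q.2).trace

/-- The norm of `M_m(𝒩_n)`: the completely bounded norm of the operator
`ℬ(ℂⁿ) → M_m, a ↦ (tr (u_{kl} a))`, where `M_r(ℬ(ℂⁿ))` carries the operator norm of
`ℬ(ℂʳ ⊗ ℂⁿ)`. -/
noncomputable def dualNorm {m : ℕ} (u : Matrix (Fin m) (Fin m) (Matrix (Fin n) (Fin n) ℂ)) : ℝ :=
  sSup {c : ℝ | ∃ (r : ℕ) (a : Matrix (Fin r) (Fin r) (Matrix (Fin n) (Fin n) ℂ)),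
    ‖Matrix.comp _ _ _ _ _ a‖ ≤ 1 ∧ ‖pairing u a‖ = c}

open scoped Kronecker in
theorem pairing_bound {m : ℕ} (u : Matrix (Fin m) (Fin m) (Matrix (Fin n) (Fin n) ℂ)) :
    ∃ C : ℝ, ∀ (r : ℕ) (a : Matrix (Fin r) (Fin r) (Matrix (Fin n) (Fin n) ℂ)),
      ‖Matrix.comp _ _ _ _ _ a‖ ≤ 1 → ‖pairing u a‖ ≤ C := by
  refine ⟨∑ p, ∑ q, ‖(Matrix.of fun k l => u k l p q : Matrix (Fin m) (Fin m) ℂ)‖,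
    fun r a ha => ?_⟩
  have h : pairing u a = ∑ p, ∑ q, (Matrix.of fun k l => u k l p q : Matrix (Fin m) (Fin m) ℂ) ⊗ₖ
      (Matrix.of fun i j => a i j q p : Matrix (Fin r) (Fin r) ℂ) := by
    ext x y
    simp [pairing, Matrix.trace, Matrix.mul_apply, Matrix.sum_apply]
  rw [h]
  refine (norm_sum_le _ _).trans (Finset.sum_le_sum fun p _ => ?_)
  refine (norm_sum_le _ _).trans (Finset.sum_le_sum fun q _ => ?_)
  refine (norm_kronecker_le _ _).trans ?_
  refine mul_le_of_le_one_right (norm_nonneg _) (le_trans ?_ ha)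
  exact norm_submatrix_le (Matrix.comp _ _ _ _ _ a) (f := fun i => (i, q)) (g := fun i => (i, p))
    (fun _ _ e => (Prod.ext_iff.1 e).1) (fun _ _ e => (Prod.ext_iff.1 e).1)

variable {m : ℕ} (u : Matrix (Fin m) (Fin m) (Matrix (Fin n) (Fin n) ℂ))

theorem le_dualNorm {r : ℕ} (a : Matrix (Fin r) (Fin r) (Matrix (Fin n) (Fin n) ℂ))
    (ha : ‖Matrix.comp _ _ _ _ _ a‖ ≤ 1) : ‖pairing u a‖ ≤ dualNorm u := by
  obtain ⟨C, hC⟩ := pairing_bound u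
  refine le_csSup ⟨C, ?_⟩ ⟨r, a, ha, rfl⟩
  rintro c ⟨r, a, ha, rfl⟩
  exact hC r a ha

theorem dualNorm_le {c : ℝ} (h : ∀ (r : ℕ) (a : Matrix (Fin r) (Fin r) (Matrix (Fin n) (Fin n) ℂ)),
    ‖Matrix.comp _ _ _ _ _ a‖ ≤ 1 → ‖pairing u a‖ ≤ c) : dualNorm u ≤ c := by
  refine csSup_le ⟨_, 0, 0, ?_, rfl⟩ ?_
  · rw [show Matrix.comp (Fin 0) (Fin 0) (Fin n) (Fin n) ℂ 0 = 0 from rfl, norm_zero]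
    exact zero_le_one
  · rintro c ⟨r, a, ha, rfl⟩
    exact h r a ha

theorem dualNorm_nonneg : 0 ≤ dualNorm u := by
  apply Real.sSup_nonneg
  rintro c ⟨r, a, -, rfl⟩
  exact norm_nonneg _

theorem dualNorm_add_le (w : Matrix (Fin m) (Fin m) (Matrix (Fin n) (Fin n) ℂ)) :
    dualNorm (u + w) ≤ dualNorm u + dualNorm w := by
  refine dualNorm_le _ fun r a ha => ?_
  have : pairing (u + w) a = pairing u a + pairing w a := by
    ext p q
    simp [pairing, add_mul]
  rw [this]
  exact (norm_add_le _ _).trans (add_le_add (le_dualNorm u a ha) (le_dualNorm w a ha))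

theorem dualNorm_smul (c : ℂ) : dualNorm (c • u) = ‖c‖ * dualNorm u := by
  have key : ∀ (c : ℂ) (u : Matrix (Fin m) (Fin m) (Matrix (Fin n) (Fin n) ℂ)),
      dualNorm (c • u) ≤ ‖c‖ * dualNorm u := by
    intro c u
    refine dualNorm_le _ fun r a ha => ?_
    have : pairing (c • u) a = c • pairing u a := by
      ext p q
      simp [pairing]
    rw [this, norm_smul]
    exact mul_le_mul_of_nonneg_left (le_dualNorm u a ha) (norm_nonneg _)
  refine le_antisymm (key c u) ?_
  rcases eq_or_ne c 0 with rfl | hc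
  · rw [norm_zero, zero_mul]
    exact dualNorm_nonneg _
  · have := key c⁻¹ (c • u)
    rwa [smul_smul, inv_mul_cancel₀ hc, one_smul, norm_inv,
      le_inv_mul_iff₀ (norm_pos_iff.2 hc)] at this

theorem eq_zero_of_dualNorm (h : dualNorm u = 0) : u = 0 := by
  refine Matrix.ext fun k l => Matrix.ext fun i j => ?_
  have key : ∀ b : Matrix (Fin n) (Fin n) ℂ, (u k l * b).trace = 0 := by
    intro b
    let a : Matrix (Fin 1) (Fin 1) (Matrix (Fin n) (Fin n) ℂ) := Matrix.of fun _ _ => b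
    let c : ℂ := ((‖Matrix.comp _ _ _ _ _ a‖ + 1 : ℝ) : ℂ)⁻¹
    have hpos : 0 < ‖Matrix.comp _ _ _ _ _ a‖ + 1 := by positivity
    have hc : c ≠ 0 := inv_ne_zero (by exact_mod_cast hpos.ne')
    have ha : ‖Matrix.comp _ _ _ _ _ (c • a)‖ ≤ 1 := by
      have : Matrix.comp _ _ _ _ _ (c • a) = c • Matrix.comp _ _ _ _ _ a := rfl
      rw [this, norm_smul, norm_inv, Complex.norm_real, Real.norm_of_nonneg hpos.le,
        inv_mul_le_iff₀ hpos]
      linarith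
    have h1 := le_dualNorm u (c • a) ha
    rw [h] at h1
    have h2 := norm_le_zero_iff.1 h1
    have h3 := congrFun (congrFun h2 (k, 0)) (l, 0)
    simpa [pairing, a, hc] using h3
  have := key (Matrix.single j i 1)
  rw [Matrix.trace_mul_single] at this
  simpa using this

theorem dualNorm_directSum {m' : ℕ} (w : Matrix (Fin m') (Fin m') (Matrix (Fin n) (Fin n) ℂ)) :
    dualNorm ((Matrix.fromBlocks u 0 0 w).submatrix finSumFinEquiv.symm finSumFinEquiv.symm) =
      max (dualNorm u) (dualNorm w) := by
  set z := (Matrix.fromBlocks u 0 0 w).submatrix finSumFinEquiv.symm finSumFinEquiv.symm with hz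
  apply le_antisymm
  · refine dualNorm_le _ fun r a ha => ?_
    let e : Fin (m + m') × Fin r → (Fin m × Fin r) ⊕ (Fin m' × Fin r) :=
      fun p => Sum.elim (fun k => Sum.inl (k, p.2)) (fun k => Sum.inr (k, p.2))
        (finSumFinEquiv.symm p.1)
    have he : e.Injective := by
      rintro ⟨p, i⟩ ⟨q, j⟩ hpq
      obtain ⟨p, rfl⟩ := finSumFinEquiv.surjective p
      obtain ⟨q, rfl⟩ := finSumFinEquiv.surjective q
      rcases p with p | p <;> rcases q with q | q <;> simp [e] at hpq ⊢ <;> exact hpq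
    have h1 : pairing z a =
        (Matrix.fromBlocks (pairing u a) 0 0 (pairing w a)).submatrix e e := by
      ext ⟨p, i⟩ ⟨q, j⟩
      obtain ⟨p, rfl⟩ := finSumFinEquiv.surjective p
      obtain ⟨q, rfl⟩ := finSumFinEquiv.surjective q
      rcases p with p | p <;> rcases q with q | q <;> simp [e, hz, pairing]
    rw [h1]
    exact (norm_submatrix_le _ he he).trans ((norm_fromBlocks_le _ _).trans
      (max_le_max (le_dualNorm u a ha) (le_dualNorm w a ha)))
  · apply max_le
    · refine dualNorm_le _ fun r a ha => ?_
      refine le_trans ?_ (le_dualNorm z a ha)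
      have h1 : pairing u a = (pairing z a).submatrix
          (fun p => (finSumFinEquiv (Sum.inl p.1), p.2))
          (fun p => (finSumFinEquiv (Sum.inl p.1), p.2)) := by
        ext p q
        simp [hz, pairing]
      rw [h1]
      have inj : Function.Injective
          (fun p : Fin m × Fin r => ((finSumFinEquiv (Sum.inl p.1) : Fin (m + m')), p.2)) := by
        rintro ⟨p, i⟩ ⟨q, j⟩ hpq
        simpa using hpq
      exact norm_submatrix_le _ inj inj
    · refine dualNorm_le _ fun r a ha => ?_
      refine le_trans ?_ (le_dualNorm z a ha)
      have h1 : pairing w a = (pairing z a).submatrix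
          (fun p => (finSumFinEquiv (Sum.inr p.1), p.2))
          (fun p => (finSumFinEquiv (Sum.inr p.1), p.2)) := by
        ext p q
        simp [hz, pairing]
      rw [h1]
      have inj : Function.Injective
          (fun p : Fin m' × Fin r => ((finSumFinEquiv (Sum.inr p.1) : Fin (m + m')), p.2)) := by
        rintro ⟨p, i⟩ ⟨q, j⟩ hpq
        simpa using hpq
      exact norm_submatrix_le _ inj inj

open scoped Kronecker in
theorem dualNorm_mul_mul_le {m' : ℕ} (α : Matrix (Fin m') (Fin m) ℂ)
    (β : Matrix (Fin m) (Fin m') ℂ) :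
    dualNorm (Matrix.of fun i j => ∑ k, ∑ l, (α i k * β l j) • u k l) ≤
      ‖α‖ * dualNorm u * ‖β‖ := by
  refine dualNorm_le _ fun r a ha => ?_
  have h : pairing (Matrix.of fun i j => ∑ k, ∑ l, (α i k * β l j) • u k l) a =
      (α ⊗ₖ (1 : Matrix (Fin r) (Fin r) ℂ)) * pairing u a *
        (β ⊗ₖ (1 : Matrix (Fin r) (Fin r) ℂ)) := by
    ext ⟨i, s⟩ ⟨j, t⟩
    have h1 : ∀ (M : Matrix (Fin m × Fin r) (Fin m × Fin r) ℂ) q,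
        ((α ⊗ₖ (1 : Matrix (Fin r) (Fin r) ℂ)) * M) (i, s) q = ∑ k, α i k * M (k, s) q := by
      intro M q
      simp [Matrix.mul_apply, Fintype.sum_prod_type, Matrix.one_apply]
    have h2 : ∀ (M : Matrix (Fin m' × Fin r) (Fin m × Fin r) ℂ) p,
        (M * (β ⊗ₖ (1 : Matrix (Fin r) (Fin r) ℂ))) p (j, t) = ∑ l, M p (l, t) * β l j := by
      intro M p
      simp [Matrix.mul_apply, Fintype.sum_prod_type, Matrix.one_apply]
    rw [h2]
    simp only [h1, pairing, Matrix.of_apply, Finset.sum_mul, Matrix.trace_sum, Matrix.smul_mul,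
      Matrix.trace_smul, smul_eq_mul]
    rw [Finset.sum_comm]
    refine Finset.sum_congr rfl fun l _ => Finset.sum_congr rfl fun k _ => ?_
    ring
  rw [h]
  refine (Matrix.l2_opNorm_mul _ _).trans ?_
  refine mul_le_mul ((Matrix.l2_opNorm_mul _ _).trans ?_) (norm_kronecker_one_le β)
    (norm_nonneg _) (mul_nonneg (norm_nonneg _) (dualNorm_nonneg u))
  exact mul_le_mul (norm_kronecker_one_le α) (le_dualNorm u a ha) (norm_nonneg _) (norm_nonneg _)

end Pairing

section Instances

variable (n : ℕ)

noncomputable instance : AddCommGroup (NuclearSpace.{u} n) :=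
  inferInstanceAs (AddCommGroup (ULift.{u} (Matrix (Fin n) (Fin n) ℂ)))

noncomputable instance : Module ℂ (NuclearSpace.{u} n) :=
  inferInstanceAs (Module ℂ (ULift.{u} (Matrix (Fin n) (Fin n) ℂ)))

variable {n}

/-- The `n × n` matrix that represents an element of `𝒩_n`. -/
def toMatrix : NuclearSpace.{u} n ≃ₗ[ℂ] Matrix (Fin n) (Fin n) ℂ := ULift.moduleEquiv

/-- The norm of `𝒩_n = M_1(𝒩_n)`, the dual norm of `ℬ(ℂⁿ)`, i.e. the trace class norm. -/
noncomputable instance : Norm (NuclearSpace.{u} n) :=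
  ⟨fun b => dualNorm (m := 1) (Matrix.of fun _ _ => toMatrix b)⟩

theorem core : NormedSpace.Core ℂ (NuclearSpace.{u} n) where
  norm_nonneg b := dualNorm_nonneg _
  norm_smul c b := dualNorm_smul (m := 1) (Matrix.of fun _ _ => toMatrix b) c
  norm_triangle b b' := dualNorm_add_le (m := 1) (Matrix.of fun _ _ => toMatrix b)
    (Matrix.of fun _ _ => toMatrix b')
  norm_eq_zero_iff b := by
    constructor
    · intro h
      have := congrFun (congrFun (eq_zero_of_dualNorm _ h) 0) 0
      exact toMatrix.map_eq_zero_iff.1 this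
    · rintro rfl
      have := dualNorm_smul (n := n) (m := 1) 0 0
      rwa [zero_smul, norm_zero, zero_mul] at this

noncomputable instance : NormedAddCommGroup (NuclearSpace.{u} n) := NormedAddCommGroup.ofCore core

noncomputable instance : NormedSpace ℂ (NuclearSpace.{u} n) := NormedSpace.ofCore core

noncomputable instance : QuantumSpace (NuclearSpace.{u} n) where
  mnorm _ v := dualNorm (v.map toMatrix)
  mnorm_add_le _ v w := by
    rw [Matrix.map_add toMatrix (map_add toMatrix)]
    exact dualNorm_add_le _ _
  mnorm_smul _ c v := by
    rw [Matrix.map_smul toMatrix c (map_smul toMatrix c)]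
    exact dualNorm_smul _ c
  eq_zero_of_mnorm_eq_zero _ v h := by
    have := eq_zero_of_dualNorm _ h
    ext i j : 2
    exact toMatrix.map_eq_zero_iff.1 (congrFun (congrFun this i) j)
  mnorm_one v := by
    change dualNorm _ = dualNorm _
    congr 1
    ext i j : 2
    rw [Subsingleton.elim i 0, Subsingleton.elim j 0]
    rfl
  mnorm_directSum m n v w := by
    rw [← dualNorm_directSum, ← Matrix.submatrix_map, Matrix.fromBlocks_map,
      Matrix.map_zero _ (map_zero toMatrix), Matrix.map_zero _ (map_zero toMatrix)]
  mnorm_mul_mul_le m n α v β := by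
    have : (Matrix.of fun i j => ∑ k, ∑ l, (α i k * β l j) • v k l).map toMatrix =
        Matrix.of fun i j => ∑ k, ∑ l, (α i k * β l j) • (v.map toMatrix) k l := by
      ext i j : 2
      simp [map_sum]
    rw [this]
    exact dualNorm_mul_mul_le _ α β

instance : FiniteDimensional ℂ (NuclearSpace.{u} n) :=
  toMatrix.symm.finiteDimensional

instance : CompleteSpace (NuclearSpace.{u} n) := FiniteDimensional.complete ℂ _

end Instances

end NuclearSpace

/-! ### The categories `QNor₁` and `QBan₁` -/

open CategoryTheory

/-- Objects of the category `QNor₁`: quantum spaces. -/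
structure QNor₁ : Type (u + 1) where
  of ::
  carrier : Type u
  [normedAddCommGroup : NormedAddCommGroup carrier]
  [normedSpace : NormedSpace ℂ carrier]
  [quantumSpace : QuantumSpace carrier]

namespace QNor₁

attribute [instance] normedAddCommGroup normedSpace quantumSpace

/-- Morphisms of `QNor₁`: completely contractive operators. -/
structure Hom (E F : QNor₁.{u}) : Type u where
  toLinearMap : E.carrier →ₗ[ℂ] F.carrier
  contractive : IsCompletelyContractive toLinearMap

noncomputable instance : Category.{u} QNor₁.{u} where
  Hom E F := Hom E F
  id E := ⟨LinearMap.id, fun n v => by rw [LinearMap.id_coe, Matrix.map_id]⟩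
  comp φ ψ := ⟨ψ.toLinearMap ∘ₗ φ.toLinearMap, fun n v => by
    rw [LinearMap.coe_comp, ← Matrix.map_map]
    exact (ψ.contractive n _).trans (φ.contractive n v)⟩

end QNor₁

/-- The category `QBan₁` of complete quantum spaces and completely contractive operators. -/
abbrev QBan₁ : Type (u + 1) :=
  ObjectProperty.FullSubcategory fun E : QNor₁.{u} => CompleteSpace E.carrier

/-- `𝒩_n` as an object of `QNor₁`. -/
noncomputable def QNor₁.nuclear (n : ℕ) : QNor₁.{u} := QNor₁.of (NuclearSpace.{u} n)

/-- `𝒩_n` as an object of `QBan₁`. -/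
noncomputable def QBan₁.nuclear (n : ℕ) : QBan₁.{u} :=
  ⟨QNor₁.nuclear n, inferInstanceAs (CompleteSpace (NuclearSpace.{u} n))⟩

end Quantum

/-! All four equivalences have one proof: an object is extremely projective exactly when it is a
near-retract of a free one. A free object `U` has generators of norm at most `1`; a family of values
bounded by `C` extends from the generators to a morphism of norm at most `C`, and a morphism is
determined by its values on the generators. If `P` is a near-retract of `U` through `σ`, lift the
values of `φσ` on the generators along `τ`, losing `ε/2` in norm. They extend to `ψ` on `U`,
uniqueness gives `τψ = φσ`, and composing with an almost contractive right inverse of `σ` lifts `φ`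
itself. Conversely, the free object generated by the unit ball of `P` maps coisometrically onto `P`,
and lifting the identity of `P` along this map exhibits `P` as a near-retract.

For modules, morphisms out of `A ⊗ E` are operators on `E`, and operators on an `ℓ₁`-space of
scalars are bounded families; thus `1 ⊗ δₘ` are free generators. `SumSpace` treats finitely
supported and summable families together: the former sum in any target, the latter need a complete
one.

For quantum spaces, `𝒩_n` must represent `E ↦ M_n(E)`: the universal matrix over `𝒩_n` has norm at
most `1`, and the operator given by a matrix `w` has completely bounded norm at most `‖w‖`
(`NuclearSpace.mnorm_map_ofMatrix_le`). The norms of `𝒩_n` being dual norms, the latter needs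
complete contractions of `E` into matrix algebras that almost attain a given matrix norm. This is
`exists_blockMap_norm_ge`, the analytic core. A norming functional `F` on `M_m(G)` is dominated, by
Hahn–Banach on a cone, by two positive functionals applied to `αα*` and `β*β`; written with
invertible `C` and `D`, these allow `F` to be divided on both sides, and the quotient is the
required contraction.

Coproducts are modelled on `ℓ₁`-sums of spaces `𝒩_n`. Their matrix norm is the supremum over all
contractions that are completely contractive on the summands, so the universal property is nearly
automatic; the point to check is that `M_1` recovers the `ℓ₁`-norm. -/

/-! ## Linear maps out of `ℓ₁`-sums -/

section SumSpace

/-- A normed space `V` presented as a space of absolutely summable families that contains all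
families with one nonzero entry. -/
structure SumSpace {ι : Type*} (E : ι → Type*) [∀ i, NormedAddCommGroup (E i)]
    [∀ i, NormedSpace ℂ (E i)] (V : Type*) [NormedAddCommGroup V] [NormedSpace ℂ V] where
  incl : V →ₗᵢ[ℂ] lp E 1
  single : ∀ i, E i →ₗ[ℂ] V
  incl_single_self : ∀ i x, incl (single i x) i = x
  incl_single_of_ne : ∀ i j x, j ≠ i → incl (single i x) j = 0

namespace SumSpace

variable {ι : Type*} {E : ι → Type*} [∀ i, NormedAddCommGroup (E i)] [∀ i, NormedSpace ℂ (E i)]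
  {V : Type*} [NormedAddCommGroup V] [NormedSpace ℂ V] (S : SumSpace E V)
  {F : Type*} [NormedAddCommGroup F] [NormedSpace ℂ F]

open Classical in
theorem incl_single (i : ι) (x : E i) : S.incl (S.single i x) = lp.single 1 i x := by
  ext j
  rcases eq_or_ne j i with rfl | h
  · rw [S.incl_single_self, lp.single_apply_self]
  · rw [S.incl_single_of_ne _ _ _ h, lp.single_apply_ne _ _ _ h]

theorem norm_single (i : ι) (x : E i) : ‖S.single i x‖ = ‖x‖ := by
  classical
  rw [← S.incl.norm_map, S.incl_single, lp.norm_single one_pos]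

theorem hasSum_norm (f : V) : HasSum (fun i => ‖S.incl f i‖) ‖f‖ := by
  have := lp.hasSum_norm (p := 1) (by simp) (S.incl f)
  simpa using this

theorem hasSum_single (f : V) : HasSum (fun i => S.single i (S.incl f i)) f := by
  classical
  have h := lp.hasSum_single (p := 1) ENNReal.one_ne_top (S.incl f)
  -- The inclusion is isometric, hence inducing, so convergence to `f` can be tested in the full
  -- `ℓ₁`-sum.
  rw [← S.incl.isometry.isEmbedding.isInducing.hasSum_iff (g := S.incl)]
  simpa [Function.comp_def, S.incl_single] using h

/-- All bounded families of operators into `F` can be summed over the elements of `V`. -/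
def SummableIn (F : Type*) [NormedAddCommGroup F] [NormedSpace ℂ F] : Prop :=
  ∀ (T : ∀ i, E i →ₗ[ℂ] F) (C : ℝ), (∀ i x, ‖T i x‖ ≤ C * ‖x‖) →
    ∀ f : V, Summable fun i => T i (S.incl f i)

theorem summableIn_of_complete [CompleteSpace F] : S.SummableIn F := fun _ C h f =>
  Summable.of_norm_bounded ((S.hasSum_norm f).summable.mul_left C) fun i => h i _

theorem summableIn_of_finite (hS : ∀ f : V, {i | S.incl f i ≠ 0}.Finite) : S.SummableIn F := by
  intro T C _ f
  refine summable_of_hasFiniteSupport ((hS f).subset fun i hi h0 => hi ?_)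
  change T i (S.incl f i) = 0
  rw [h0, map_zero]

/-- The operator on `V` given by a bounded family of operators on the summands. -/
noncomputable def sumMap (hF : S.SummableIn F) (T : ∀ i, E i →ₗ[ℂ] F) (C : ℝ)
    (h : ∀ i x, ‖T i x‖ ≤ C * ‖x‖) : V →ₗ[ℂ] F where
  toFun f := ∑' i, T i (S.incl f i)
  map_add' f g := by
    rw [← (hF T C h f).tsum_add (hF T C h g)]
    simp
  map_smul' c f := by
    rw [RingHom.id_apply, ← (hF T C h f).tsum_const_smul]
    simp

variable {S}

theorem norm_sumMap_le (hF : S.SummableIn F) (T : ∀ i, E i →ₗ[ℂ] F) (C : ℝ)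
    (h : ∀ i x, ‖T i x‖ ≤ C * ‖x‖) (f : V) : ‖S.sumMap hF T C h f‖ ≤ C * ‖f‖ :=
  tsum_of_norm_bounded ((S.hasSum_norm f).mul_left C) fun i => h i _

theorem sumMap_single (hF : S.SummableIn F) (T : ∀ i, E i →ₗ[ℂ] F) (C : ℝ)
    (h : ∀ i x, ‖T i x‖ ≤ C * ‖x‖) (i : ι) (x : E i) :
    S.sumMap hF T C h (S.single i x) = T i x := by
  refine (tsum_eq_single i fun j hj => ?_).trans ?_
  · rw [S.incl_single_of_ne _ _ _ hj, map_zero]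
  · rw [S.incl_single_self]

variable (S) in
/-- Bounded operators on `V` are determined by their values on the summands. -/
theorem ext_of_norm_le {f g : V →ₗ[ℂ] F} {C C' : ℝ} (hf : ∀ x, ‖f x‖ ≤ C * ‖x‖)
    (hg : ∀ x, ‖g x‖ ≤ C' * ‖x‖) (h : ∀ i x, f (S.single i x) = g (S.single i x)) : f = g := by
  ext x
  have h1 := (S.hasSum_single x).mapL (f.mkContinuous C hf)
  have h2 := (S.hasSum_single x).mapL (g.mkContinuous C' hg)
  simp only [LinearMap.mkContinuous_apply, h] at h1 h2
  exact h1.unique h2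

variable (E) in
/-- The `ℓ₁`-sum as a space of summable families. -/
noncomputable def lp : SumSpace E (lp E 1) := by
  classical exact
  { incl := LinearIsometry.id
    single := fun i => lp.lsingle 1 i
    incl_single_self := fun i x => lp.single_apply_self 1 i x
    incl_single_of_ne := fun i _ x h => lp.single_apply_ne 1 i x h }

open Classical in
/-- A subspace of the `ℓ₁`-sum that contains the families with one nonzero entry. -/
noncomputable def ofSubmodule (W : Submodule ℂ (_root_.lp E 1))
    (hW : ∀ i x, lp.single 1 i x ∈ W) : SumSpace E W where
  incl := W.subtypeₗᵢ
  single := fun i => (lp.lsingle 1 i).codRestrict W (hW i)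
  incl_single_self := fun i x => lp.single_apply_self 1 i x
  incl_single_of_ne := fun i _ x h => lp.single_apply_ne 1 i x h

variable (E) in
/-- The families with finite support in an `ℓ₁`-sum. -/
def finiteFamilies : Submodule ℂ (_root_.lp E 1) where
  carrier := {f | {i | f i ≠ 0}.Finite}
  zero_mem' := by simp
  add_mem' {f g} hf hg := (hf.union hg).subset fun i hi => by
    by_contra h
    rw [Set.mem_union, not_or] at h
    exact hi (by simp [not_not.1 h.1, not_not.1 h.2])
  smul_mem' c f hf := hf.subset fun i hi h => hi (by simp [h])

open Classical in
theorem single_mem_finiteFamilies (i : ι) (x : E i) : lp.single 1 i x ∈ finiteFamilies E := by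
  refine (Set.finite_singleton i).subset fun _ hj => ?_
  by_contra h
  exact hj (lp.single_apply_ne 1 i x h)

end SumSpace

/-- `l₁(M)` as a space of summable families. -/
noncomputable def L1.sumSpace (M : Type*) : SumSpace (fun _ : M => ℂ) (L1 M) :=
  SumSpace.lp fun _ : M => ℂ

/-- `l₁⁰(M)` as a space of summable families. -/
noncomputable def L1Zero.sumSpace (M : Type*) : SumSpace (fun _ : M => ℂ) (L1Zero M) :=
  SumSpace.ofSubmodule (finSupp M) SumSpace.single_mem_finiteFamilies

theorem L1Zero.summableIn (M : Type*) {F : Type*} [NormedAddCommGroup F] [NormedSpace ℂ F] :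
    (L1Zero.sumSpace M).SummableIn F :=
  SumSpace.summableIn_of_finite _ fun f : finSupp M => f.2

end SumSpace

/-! ## Morphisms out of projective tensor products -/

namespace ProjTensor

variable {A : Type*} [NormedRing A] [NormedAlgebra ℂ A]
  {E : Type*} [NormedAddCommGroup E] [NormedSpace ℂ E]
  {Y : Type*} [NormedAddCommGroup Y] [NormedSpace ℂ Y] [Module A Y] [IsScalarTower ℂ A Y]

/-- The elementary tensors. -/
noncomputable def tmul (a : A) (x : E) : ProjTensor A E := a ⊗ₜ[ℂ] x

theorem norm_tmul_le (a : A) (x : E) : ‖(tmul a x : ProjTensor A E)‖ ≤ ‖a‖ * ‖x‖ := by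
  have h := projNorm_le [(a, x)]
  simp only [List.map_cons, List.map_nil, List.sum_cons, List.sum_nil, add_zero] at h
  exact h

theorem smul_tmul (a b : A) (x : E) : a • (tmul b x : ProjTensor A E) = tmul (a * b) x :=
  TensorProduct.smul_tmul' a b x

/-- The morphism `a ⊗ x ↦ a • g x`. -/
noncomputable def liftHom (g : E →ₗ[ℂ] Y) : ProjTensor A E →ₗ[A] Y :=
  TensorProduct.AlgebraTensorModule.lift
    { toFun := fun a => a • g
      map_add' := fun a b => add_smul a b g
      map_smul' := fun a b => mul_smul a b g }

theorem liftHom_tmul (g : E →ₗ[ℂ] Y) (a : A) (x : E) :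
    liftHom g (tmul a x : ProjTensor A E) = a • g x := rfl

/-- The triangle inequality is applied to a representation of `t` that almost attains the projective
norm. Contractivity of the action on `Y` bounds each term `a • g x`. -/
theorem norm_liftHom_le [IsBoundedSMul A Y] (g : E →ₗ[ℂ] Y) {C : ℝ} (hC : 0 ≤ C)
    (hg : ∀ x, ‖g x‖ ≤ C * ‖x‖) (t : ProjTensor A E) : ‖liftHom g t‖ ≤ C * ‖t‖ := by
  refine le_of_forall_pos_le_add fun ε hε => ?_
  obtain ⟨s, rfl, hs⟩ := exists_lt (X := A) (E := E) (t := t)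
    -- Dividing by `C + 1` instead of `C` admits `C = 0`.
    (lt_add_of_pos_right (projNorm t) (show 0 < ε / (C + 1) by positivity))
  set t : ProjTensor A E := (s.map fun p => p.1 ⊗ₜ[ℂ] p.2).sum
  change _ < ‖t‖ + _ at hs
  have h3 : ‖liftHom g t‖ ≤ C * (s.map fun p => ‖p.1‖ * ‖p.2‖).sum := by
    subst t
    clear hs
    induction s with
    | nil =>
      simp only [List.map_nil, List.sum_nil, mul_zero]
      exact (norm_le_zero_iff.2 (map_zero (liftHom (A := A) g)))
    | cons p s ih =>
      simp only [List.map_cons, List.sum_cons]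
      refine (congrArg norm (map_add (liftHom (A := A) g) _ _)).trans_le
        ((norm_add_le _ _).trans ?_)
      have h : ‖liftHom g (tmul p.1 p.2 : ProjTensor A E)‖ ≤ C * (‖p.1‖ * ‖p.2‖) := by
        rw [liftHom_tmul]
        calc _ ≤ ‖p.1‖ * ‖g p.2‖ := norm_smul_le _ _
          _ ≤ ‖p.1‖ * (C * ‖p.2‖) := by gcongr; exact hg _
          _ = _ := by ring
      exact (add_le_add h ih).trans_eq (mul_add _ _ _).symm
  have h4 := mul_le_mul_of_nonneg_left hs.le hC
  have h5 : C * (ε / (C + 1)) ≤ ε := by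
    rw [mul_div_assoc', div_le_iff₀ (by positivity)]
    nlinarith
  linarith

/-- Morphisms of `A ⊗ₚ E` are determined by their values on `1 ⊗ E`. -/
theorem hom_ext {f g : ProjTensor A E →ₗ[A] Y}
    (h : ∀ x, f (tmul 1 x) = g (tmul 1 x)) : f = g := by
  refine TensorProduct.AlgebraTensorModule.ext fun a x => ?_
  have : (a ⊗ₜ[ℂ] x : A ⊗[ℂ] E) = a • (tmul 1 x : ProjTensor A E) := by
    rw [smul_tmul, mul_one]; rfl
  rw [this]
  exact (map_smul f a _).trans ((congrArg (a • ·) (h x)).trans (map_smul g a _).symm)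

end ProjTensor

/-! ## Free modules and extreme projectivity -/

section Free

/-- Rescaling by `C` passes from the unit ball to the ball of radius `C`; only homogeneity of `τ` is
needed. -/
theorem IsCoisometric.exists_lift {E F : Type*} [NormedAddCommGroup E] [NormedSpace ℂ E]
    [NormedAddCommGroup F] [NormedSpace ℂ F] {τ : E → F} (hτ : IsCoisometric τ)
    (hτ' : ∀ (c : ℂ) x, τ (c • x) = c • τ x) {x : F} {C : ℝ} (hx : ‖x‖ < C) :
    ∃ y, τ y = x ∧ ‖y‖ < C := by
  have hC : 0 < C := (norm_nonneg x).trans_lt hx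
  have hC' : (C : ℂ) ≠ 0 := by exact_mod_cast hC.ne'
  have hn : ‖(C : ℂ)‖ = C := by rw [Complex.norm_real, Real.norm_of_nonneg hC.le]
  have : (C : ℂ)⁻¹ • x ∈ Metric.ball (0 : F) 1 := by
    rw [mem_ball_zero_iff, norm_smul, norm_inv, hn, inv_mul_lt_iff₀ hC, mul_one]
    exact hx
  rw [← hτ] at this
  obtain ⟨y, hy, h⟩ := this
  refine ⟨(C : ℂ) • y, ?_, ?_⟩
  · rw [hτ', h, smul_smul, mul_inv_cancel₀ hC', one_smul]
  · rw [norm_smul, hn]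
    rw [mem_ball_zero_iff] at hy
    exact (mul_lt_iff_lt_one_right hC).2 hy

variable {A : Type*} [NormedRing A] [NormedAlgebra ℂ A]
  {P : Type*} [NormedAddCommGroup P] [NormedSpace ℂ P] [Module A P] [IsScalarTower ℂ A P]
  {U : Type*} [NormedAddCommGroup U] [NormedSpace ℂ U] [Module A U] [IsScalarTower ℂ A U]
  {X : Type*} [NormedAddCommGroup X] [NormedSpace ℂ X] [Module A X] [IsScalarTower ℂ A X]
  {Y : Type*} [NormedAddCommGroup Y] [NormedSpace ℂ Y] [Module A Y] [IsScalarTower ℂ A Y]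

theorem norm_apply_le_morphismNorm (φ : X →L[A] Y) (x : X) : ‖φ x‖ ≤ morphismNorm φ * ‖x‖ :=
  (φ.restrictScalars ℂ).le_opNorm x

theorem morphismNorm_le {φ : X →L[A] Y} {C : ℝ} (hC : 0 ≤ C) (h : ∀ x, ‖φ x‖ ≤ C * ‖x‖) :
    morphismNorm φ ≤ C :=
  (φ.restrictScalars ℂ).opNorm_le_bound hC h

theorem morphismNorm_nonneg (φ : X →L[A] Y) : 0 ≤ morphismNorm φ := norm_nonneg _

theorem morphismNorm_comp_le (ψ : X →L[A] Y) (φ : P →L[A] X) :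
    morphismNorm (ψ.comp φ) ≤ morphismNorm ψ * morphismNorm φ :=
  (ψ.restrictScalars ℂ).opNorm_comp_le (φ.restrictScalars ℂ)

/-- `Y` admits the morphisms from the module `U` freely generated by the family `e`. -/
def ExtendsTo {M : Type*} (e : M → U) (Y : Type*) [NormedAddCommGroup Y] [NormedSpace ℂ Y]
    [Module A Y] [IsScalarTower ℂ A Y] : Prop :=
  ∀ (y : M → Y) (C : ℝ), 0 ≤ C → (∀ m, ‖y m‖ ≤ C) →
    ∃ ψ : U →L[A] Y, (∀ m, ψ (e m) = y m) ∧ morphismNorm ψ ≤ C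

/-- Half of `ε` pays for lifting the generators, the other half for the right inverse of the
near-retraction. Existence of extensions is needed only into `Y`, uniqueness only into `X`. -/
theorem exists_lift_of_isNearRetract {M : Type*} {e : M → U} (he : ∀ m, ‖e m‖ ≤ 1)
    (hY : ExtendsTo (A := A) e Y)
    (hX : ∀ f g : U →L[A] X, (∀ m, f (e m) = g (e m)) → f = g)
    (hP : IsNearRetract A P U) (τ : Y →L[A] X) (hτ : IsCoisometric τ) (φ : P →L[A] X)
    (ε : ℝ) (hε : 0 < ε) :
    ∃ ψ : P →L[A] Y, τ.comp ψ = φ ∧ morphismNorm ψ < morphismNorm φ + ε := by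
  obtain ⟨σ, hσ, hζ⟩ := hP
  set C := morphismNorm φ + ε / 2
  have hC : 0 < C := by have := morphismNorm_nonneg φ; positivity
  have h1 : ∀ m, ∃ y, τ y = φ (σ (e m)) ∧ ‖y‖ < C := fun m => by
    refine hτ.exists_lift (fun c x => (τ.restrictScalars ℂ).map_smul c x) ?_
    calc ‖φ (σ (e m))‖ ≤ morphismNorm φ * ‖σ (e m)‖ := norm_apply_le_morphismNorm _ _
      _ ≤ morphismNorm φ * (1 * 1) := by
        gcongr
        · exact morphismNorm_nonneg φ
        · exact (norm_apply_le_morphismNorm _ _).trans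
            (mul_le_mul hσ (he m) (norm_nonneg _) zero_le_one)
      _ < C := by simp only [mul_one]; exact lt_add_of_pos_right _ (half_pos hε)
  choose y hy hyC using h1
  obtain ⟨ψ, hψ, hψC⟩ := hY y C hC.le fun m => (hyC m).le
  -- Chosen so that `C * (1 + ε / 2 / C) = C + ε / 2`, which is `morphismNorm φ + ε`.
  obtain ⟨ζ, hζ1, hζ2⟩ := hζ (ε / 2 / C) (by positivity)
  refine ⟨ψ.comp ζ, ?_, ?_⟩
  · have : τ.comp ψ = φ.comp σ := hX _ _ fun m => by simp [hψ, hy]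
    rw [← ContinuousLinearMap.comp_assoc, this, ContinuousLinearMap.comp_assoc, hζ1,
      ContinuousLinearMap.comp_id]
  · calc morphismNorm (ψ.comp ζ) ≤ morphismNorm ψ * morphismNorm ζ := morphismNorm_comp_le _ _
      _ ≤ C * morphismNorm ζ := mul_le_mul_of_nonneg_right hψC (morphismNorm_nonneg _)
      _ < C * (1 + ε / 2 / C) := mul_lt_mul_of_pos_left hζ2 hC
      _ = morphismNorm φ + ε := by
        rw [mul_add, mul_div_cancel₀ _ hC.ne']
        ring

/-- Each generator is sent to the point of the ball that indexes it. A point `p` of the open ball is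
then the image of `c` times the generator indexed by `c⁻¹ • p`, where `‖p‖ < c < 1`. -/
theorem exists_isCoisometric {e : Metric.closedBall (0 : P) 1 → U} (he : ∀ m, ‖e m‖ ≤ 1)
    (hP : ExtendsTo (A := A) e P) :
    ∃ σ : U →L[A] P, IsCoisometric σ ∧ morphismNorm σ ≤ 1 := by
  obtain ⟨σ, hσ, hσ1⟩ := hP (fun m => m) 1 zero_le_one fun m => mem_closedBall_zero_iff.1 m.2
  refine ⟨σ, Set.Subset.antisymm ?_ fun p hp => ?_, hσ1⟩
  · rintro _ ⟨x, hx, rfl⟩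
    rw [mem_ball_zero_iff] at hx ⊢
    refine lt_of_le_of_lt ?_ hx
    simpa using (norm_apply_le_morphismNorm σ x).trans
      (mul_le_mul_of_nonneg_right hσ1 (norm_nonneg _))
  · rw [mem_ball_zero_iff] at hp
    obtain ⟨c, hc, hc1⟩ := exists_between hp
    have hc0 : 0 < c := (norm_nonneg p).trans_lt hc
    have hc' : (c : ℂ) ≠ 0 := by exact_mod_cast hc0.ne'
    have hn : ‖(c : ℂ)‖ = c := by rw [Complex.norm_real, Real.norm_of_nonneg hc0.le]
    let m : Metric.closedBall (0 : P) 1 := ⟨(c : ℂ)⁻¹ • p, by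
      rw [mem_closedBall_zero_iff, norm_smul, norm_inv, hn, inv_mul_le_iff₀ hc0, mul_one]
      exact hc.le⟩
    refine ⟨(c : ℂ) • e m, ?_, ?_⟩
    · rw [mem_ball_zero_iff, norm_smul, hn]
      exact (mul_le_of_le_one_right hc0.le (he m)).trans_lt hc1
    · refine ((σ.restrictScalars ℂ).map_smul _ _).trans ?_
      change (c : ℂ) • σ (e m) = p
      rw [hσ, smul_smul, mul_inv_cancel₀ hc', one_smul]

theorem isNearRetract_of_lift {σ : U →L[A] P} (hσ : morphismNorm σ ≤ 1)
    (h : ∀ ε : ℝ, 0 < ε → ∃ ψ : P →L[A] U, σ.comp ψ = ContinuousLinearMap.id A P ∧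
      morphismNorm ψ < morphismNorm (ContinuousLinearMap.id A P) + ε) :
    IsNearRetract A P U := by
  refine ⟨σ, hσ, fun ε hε => ?_⟩
  obtain ⟨ζ, h1, h2⟩ := h ε hε
  -- Only an inequality: the identity of the zero module has norm `0`.
  have : morphismNorm (ContinuousLinearMap.id A P) ≤ 1 :=
    morphismNorm_le zero_le_one fun x => by simp
  exact ⟨ζ, h1, by linarith⟩

end Free

/-! ### Free generators of `A ⊗ₚ l₁⁰(M)` and `A ⊗̂ l₁(M)` -/

section Generators

variable {A : Type*} [NormedRing A] [NormedAlgebra ℂ A]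
  {X : Type*} [NormedAddCommGroup X] [NormedSpace ℂ X] [Module A X] [IsScalarTower ℂ A X]
  {M : Type*}

namespace ProjTensor

variable {E : Type*} [NormedAddCommGroup E] [NormedSpace ℂ E]
  (S : SumSpace (fun _ : M => ℂ) E)

variable (A) in
/-- The generator `1 ⊗ δₘ`. -/
noncomputable def generator (m : M) : ProjTensor A E := tmul 1 (S.single m 1)

theorem norm_generator_le (hA : ‖(1 : A)‖ ≤ 1) (m : M) : ‖generator A S m‖ ≤ 1 := by
  refine (norm_tmul_le _ _).trans ?_
  rw [S.norm_single, norm_one (α := ℂ), mul_one]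
  exact hA

/-- Two universal properties are composed: a bounded family of vectors is an operator on the
`ℓ₁`-space, and an operator on `E` is a morphism on `A ⊗ₚ E`. -/
theorem exists_extension [IsBoundedSMul A X] (hX : S.SummableIn X) (y : M → X) {C : ℝ}
    (hC : 0 ≤ C) (hy : ∀ m, ‖y m‖ ≤ C) :
    ∃ ψ : ProjTensor A E →L[A] X, (∀ m, ψ (generator A S m) = y m) ∧ ∀ t, ‖ψ t‖ ≤ C * ‖t‖ := by
  have hT : ∀ m x, ‖LinearMap.toSpanSingleton ℂ X (y m) x‖ ≤ C * ‖x‖ := fun m x => by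
    rw [LinearMap.toSpanSingleton_apply, norm_smul, mul_comm]
    exact mul_le_mul_of_nonneg_right (hy m) (norm_nonneg x)
  have hb := norm_liftHom_le (A := A) (S.sumMap hX _ C hT) hC
    (SumSpace.norm_sumMap_le hX _ C hT)
  refine ⟨⟨liftHom (S.sumMap hX _ C hT), ?_⟩, fun m => ?_, hb⟩
  · exact (((liftHom (A := A) (S.sumMap hX _ C hT)).restrictScalars ℂ).mkContinuous C hb).cont
  · change liftHom (A := A) (S.sumMap hX _ C hT) (generator A S m) = _
    rw [generator, liftHom_tmul, SumSpace.sumMap_single]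
    simp

theorem continuousLinearMap_ext {f g : ProjTensor A E →L[A] X}
    (h : ∀ m, f (generator A S m) = g (generator A S m)) : f = g := by
  -- The unit families span only a dense subspace of `E` in general, so boundedness of `x ↦ f (1 ⊗
  -- x)` is required before comparing on them.
  have key : ∀ f : ProjTensor A E →L[A] X, ∃ C : ℝ, ∀ x, ‖f (tmul 1 x)‖ ≤ C * ‖x‖ := fun f => by
    refine ⟨morphismNorm f * ‖(1 : A)‖, fun x => ?_⟩
    rw [mul_assoc]
    exact (norm_apply_le_morphismNorm f _).trans
      (mul_le_mul_of_nonneg_left (norm_tmul_le _ _) (morphismNorm_nonneg f))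
  let j : E →ₗ[ℂ] ProjTensor A E := TensorProduct.mk ℂ A E 1
  obtain ⟨C, hC⟩ := key f
  obtain ⟨C', hC'⟩ := key g
  have h1 : (f.restrictScalars ℂ).toLinearMap ∘ₗ j = (g.restrictScalars ℂ).toLinearMap ∘ₗ j := by
    refine S.ext_of_norm_le hC hC' fun m x => ?_
    have : S.single m x = x • S.single m 1 := by rw [← map_smul, smul_eq_mul, mul_one]
    rw [this, map_smul, map_smul]
    exact congrArg (x • ·) (h m)
  have h2 : f.toLinearMap = g.toLinearMap := hom_ext fun x => LinearMap.congr_fun h1 x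
  exact ContinuousLinearMap.coe_injective h2

end ProjTensor

theorem ProjTensor.extendsTo [IsBoundedSMul A X] :
    ExtendsTo (A := A) (ProjTensor.generator A (L1Zero.sumSpace M)) X := fun y C hC hy => by
  obtain ⟨ψ, h1, h2⟩ := ProjTensor.exists_extension (A := A) _ (L1Zero.summableIn M) y hC hy
  exact ⟨ψ, h1, morphismNorm_le hC h2⟩

theorem CompletedProjTensor.extendsTo [IsBoundedSMul A X] [CompleteSpace X] :
    ExtendsTo (A := A) (U := CompletedProjTensor A (L1 M))
      (fun m => (ProjTensor.generator A (L1.sumSpace M) m : CompletedProjTensor A (L1 M))) X :=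
  fun y C hC hy => by
  obtain ⟨ψ, h1, h2⟩ := ProjTensor.exists_extension (A := A) (L1.sumSpace M)
    (SumSpace.summableIn_of_complete _) y hC hy
  let e : ProjTensor A (L1 M) →L[A] CompletedProjTensor A (L1 M) :=
    ⟨{ toFun := fun t => t
       map_add' := UniformSpace.Completion.coe_add
       map_smul' := fun a t => UniformSpace.Completion.coe_smul a t },
      UniformSpace.Completion.continuous_coe _⟩
  have hd : DenseRange e := UniformSpace.Completion.denseRange_coe
  have hi : IsUniformInducing e := UniformSpace.Completion.isUniformInducing_coe _
  have he : ∀ t : ProjTensor A (L1 M), ψ.extend e (t : CompletedProjTensor A (L1 M)) = ψ t :=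
    fun t => ψ.extend_eq hd hi t
  -- The norm bound is a closed condition, so it passes from the dense image of `A ⊗ₚ l₁(M)` to the
  -- completion.
  refine ⟨ψ.extend e, fun m => (he _).trans (h1 m), morphismNorm_le hC fun t => ?_⟩
  induction t using UniformSpace.Completion.induction_on with
  | hp => exact isClosed_le (by fun_prop) (by fun_prop)
  | ih t =>
    rw [he, UniformSpace.Completion.norm_coe]
    exact h2 t

theorem CompletedProjTensor.ext {f g : CompletedProjTensor A (L1 M) →L[A] X}
    (h : ∀ m, f (ProjTensor.generator A (L1.sumSpace M) m : CompletedProjTensor A (L1 M)) =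
      g (ProjTensor.generator A (L1.sumSpace M) m : CompletedProjTensor A (L1 M))) : f = g := by
  let e : ProjTensor A (L1 M) →L[A] CompletedProjTensor A (L1 M) :=
    ⟨{ toFun := fun t => t
       map_add' := UniformSpace.Completion.coe_add
       map_smul' := fun a t => UniformSpace.Completion.coe_smul a t },
      UniformSpace.Completion.continuous_coe _⟩
  have h1 : f.comp e = g.comp e :=
    ProjTensor.continuousLinearMap_ext (L1.sumSpace M) h
  ext t
  induction t using UniformSpace.Completion.induction_on with
  | hp => exact isClosed_eq (by fun_prop) (by fun_prop)
  | ih t => exact DFunLike.congr_fun h1 t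

end Generators

/-! ### Extremely projective normed and Banach modules -/

theorem isExtremelyProjective_iff (A : Type u) [NormedRing A] [NormedAlgebra ℂ A]
    (hA : ‖(1 : A)‖ ≤ 1) (P : Type u) [NormedAddCommGroup P] [NormedSpace ℂ P] [Module A P]
    [IsScalarTower ℂ A P] [IsBoundedSMul A P] :
    IsExtremelyProjective A P ↔ ∃ M : Type u, IsNearRetract A P (ProjTensor A (L1Zero M)) := by
  constructor
  · intro h
    obtain ⟨σ, hσ, hσ1⟩ := exists_isCoisometric (A := A) (P := P)
      (ProjTensor.norm_generator_le (L1Zero.sumSpace _) hA) ProjTensor.extendsTo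
    exact ⟨_, isNearRetract_of_lift hσ1 fun ε hε => h _ _ σ hσ _ ε hε⟩
  · rintro ⟨M, hM⟩ Y X _ _ _ _ _ _ _ _ _ _ τ hτ φ ε hε
    exact exists_lift_of_isNearRetract (ProjTensor.norm_generator_le (L1Zero.sumSpace M) hA)
      ProjTensor.extendsTo (fun f g => ProjTensor.continuousLinearMap_ext _) hM τ hτ φ ε hε

theorem isBanachExtremelyProjective_iff (A : Type u) [NormedRing A] [NormedAlgebra ℂ A]
    (hA : ‖(1 : A)‖ ≤ 1) (P : Type u) [NormedAddCommGroup P] [NormedSpace ℂ P] [Module A P]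
    [IsScalarTower ℂ A P] [IsBoundedSMul A P] [CompleteSpace P] :
    IsBanachExtremelyProjective A P ↔
      ∃ M : Type u, IsNearRetract A P (CompletedProjTensor A (L1 M)) := by
  have he : ∀ (M : Type u) (m : M), ‖(ProjTensor.generator A (L1.sumSpace M) m :
      CompletedProjTensor A (L1 M))‖ ≤ 1 := fun M m => by
    rw [UniformSpace.Completion.norm_coe]
    exact ProjTensor.norm_generator_le _ hA m
  constructor
  · intro h
    obtain ⟨σ, hσ, hσ1⟩ := exists_isCoisometric (A := A) (P := P) (he _)
      CompletedProjTensor.extendsTo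
    exact ⟨_, isNearRetract_of_lift hσ1 fun ε hε => h _ _ σ hσ _ ε hε⟩
  · rintro ⟨M, hM⟩ Y X _ _ _ _ _ _ _ _ _ _ _ _ τ hτ φ ε hε
    exact exists_lift_of_isNearRetract (he M) CompletedProjTensor.extendsTo
      (fun f g => CompletedProjTensor.ext) hM τ hτ φ ε hε

/-! ## Matrix norms of quantum spaces -/

section QuantumBasics

open scoped Matrix.Norms.L2Operator
open QuantumSpace (mnorm)

/-- The two-sided product `α v β` of a matrix `v` over a linear space with scalar matrices. -/
def sandwich {E : Type*} [AddCommGroup E] [Module ℂ E] {k l m n : Type*} [Fintype k] [Fintype l]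
    (α : Matrix m k ℂ) (v : Matrix k l E) (β : Matrix l n ℂ) : Matrix m n E :=
  Matrix.of fun i j => ∑ k, ∑ l, (α i k * β l j) • v k l

section Sandwich

variable {E F : Type*} [AddCommGroup E] [Module ℂ E] [AddCommGroup F] [Module ℂ F]
  {k l m n m' n' : Type*} [Fintype k] [Fintype l]

theorem sandwich_apply (α : Matrix m k ℂ) (v : Matrix k l E) (β : Matrix l n ℂ) (i : m) (j : n) :
    sandwich α v β i j = ∑ k, ∑ l, (α i k * β l j) • v k l := rfl

theorem sandwich_add (α : Matrix m k ℂ) (v w : Matrix k l E) (β : Matrix l n ℂ) :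
    sandwich α (v + w) β = sandwich α v β + sandwich α w β := by
  ext i j
  simp [sandwich_apply, Finset.sum_add_distrib]

theorem sandwich_smul (α : Matrix m k ℂ) (c : ℂ) (v : Matrix k l E) (β : Matrix l n ℂ) :
    sandwich α (c • v) β = c • sandwich α v β := by
  ext i j
  simp [sandwich_apply, Finset.smul_sum, smul_smul, mul_comm]

theorem sandwich_zero (α : Matrix m k ℂ) (β : Matrix l n ℂ) :
    sandwich α (0 : Matrix k l E) β = 0 := by
  ext i j
  simp [sandwich_apply]

theorem smul_sandwich (c : ℂ) (α : Matrix m k ℂ) (v : Matrix k l E) (β : Matrix l n ℂ) :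
    sandwich (c • α) v β = c • sandwich α v β := by
  ext i j
  simp [sandwich_apply, Finset.smul_sum, smul_smul, mul_assoc]

theorem sandwich_smul_right (c : ℂ) (α : Matrix m k ℂ) (v : Matrix k l E) (β : Matrix l n ℂ) :
    sandwich α v (c • β) = c • sandwich α v β := by
  ext i j
  simp [sandwich_apply, Finset.smul_sum, smul_smul, mul_left_comm]

theorem sandwich_sandwich [Fintype m] [Fintype n] (γ : Matrix m' m ℂ) (α : Matrix m k ℂ) (v : Matrix k l E)
    (β : Matrix l n ℂ) (δ : Matrix n n' ℂ) :
    sandwich γ (sandwich α v β) δ = sandwich (γ * α) v (β * δ) := by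
  have e (f : m → n → k → l → E) :
      ∑ a, ∑ b, ∑ c, ∑ d, f a b c d = ∑ c, ∑ d, ∑ a, ∑ b, f a b c d := by
    have e1 : ∑ a, ∑ b, ∑ c, ∑ d, f a b c d =
        ∑ p : m × n, ∑ q : k × l, f p.1 p.2 q.1 q.2 := by simp [Fintype.sum_prod_type]
    have e2 : ∑ c, ∑ d, ∑ a, ∑ b, f a b c d =
        ∑ q : k × l, ∑ p : m × n, f p.1 p.2 q.1 q.2 := by simp [Fintype.sum_prod_type]
    rw [e1, e2, Finset.sum_comm]
  ext i j
  simp only [sandwich_apply, Finset.smul_sum, smul_smul]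
  rw [e]
  refine Finset.sum_congr rfl fun c _ => Finset.sum_congr rfl fun d _ => ?_
  simp only [Matrix.mul_apply, Finset.sum_mul_sum, Finset.sum_smul]
  refine Finset.sum_congr rfl fun a _ => Finset.sum_congr rfl fun b _ => ?_
  congr 1
  ring

theorem one_sandwich_one [DecidableEq k] [DecidableEq l] (v : Matrix k l E) :
    sandwich 1 v 1 = v := by
  ext i j
  simp [sandwich_apply, Matrix.one_apply]

theorem map_sandwich (φ : E →ₗ[ℂ] F) (α : Matrix m k ℂ) (v : Matrix k l E) (β : Matrix l n ℂ) :
    (sandwich α v β).map φ = sandwich α (v.map φ) β := by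
  ext i j
  simp [sandwich_apply]

end Sandwich

/-- The block sum of square matrices with rows and columns numbered consecutively. -/
def blockSum {E : Type*} [Zero E] {m n : ℕ} (v : Matrix (Fin m) (Fin m) E)
    (w : Matrix (Fin n) (Fin n) E) : Matrix (Fin (m + n)) (Fin (m + n)) E :=
  (Matrix.fromBlocks v 0 0 w).submatrix finSumFinEquiv.symm finSumFinEquiv.symm

theorem map_blockSum {E F : Type*} [AddCommGroup E] [Module ℂ E] [AddCommGroup F] [Module ℂ F]
    (φ : E →ₗ[ℂ] F) {m n : ℕ} (v : Matrix (Fin m) (Fin m) E) (w : Matrix (Fin n) (Fin n) E) :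
    (blockSum v w).map φ = blockSum (v.map φ) (w.map φ) := by
  rw [blockSum, ← Matrix.submatrix_map, Matrix.fromBlocks_map,
    Matrix.map_zero _ (map_zero φ), Matrix.map_zero _ (map_zero φ)]
  rfl

/-- Together with the norm of block sums, this makes the set of products `α v β` with `‖v‖ ≤ 1`
closed under addition in a way that also adds `αα*` and `β*β`. The cone in the Hahn–Banach argument
depends on it. -/
theorem sandwich_blockSum {E : Type*} [AddCommGroup E] [Module ℂ E] {m n n' : ℕ}
    (α : Matrix (Fin m) (Fin n) ℂ) (α' : Matrix (Fin m) (Fin n') ℂ)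
    (v : Matrix (Fin n) (Fin n) E) (v' : Matrix (Fin n') (Fin n') E)
    (β : Matrix (Fin n) (Fin m) ℂ) (β' : Matrix (Fin n') (Fin m) ℂ) :
    sandwich ((Matrix.fromCols α α').submatrix id finSumFinEquiv.symm) (blockSum v v')
      ((Matrix.fromRows β β').submatrix finSumFinEquiv.symm id) =
      sandwich α v β + sandwich α' v' β' := by
  ext i j
  simp [sandwich_apply, blockSum, Fin.sum_univ_add]

variable {E F : Type*} [NormedAddCommGroup E] [NormedSpace ℂ E] [QuantumSpace E]
  [NormedAddCommGroup F] [NormedSpace ℂ F] [QuantumSpace F]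

section

variable {n : ℕ}

theorem mnorm_zero : mnorm n (0 : Matrix (Fin n) (Fin n) E) = 0 := by
  have := QuantumSpace.mnorm_smul n 0 (0 : Matrix (Fin n) (Fin n) E)
  rwa [zero_smul, norm_zero, zero_mul] at this

theorem mnorm_neg (v : Matrix (Fin n) (Fin n) E) : mnorm n (-v) = mnorm n v := by
  have := QuantumSpace.mnorm_smul n (-1) v
  rwa [neg_one_smul, norm_neg, norm_one, one_mul] at this

theorem mnorm_nonneg (v : Matrix (Fin n) (Fin n) E) : 0 ≤ mnorm n v := by
  have := QuantumSpace.mnorm_add_le n v (-v)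
  rw [add_neg_cancel, mnorm_zero, mnorm_neg] at this
  linarith

theorem mnorm_sum_le {ι : Type*} (s : Finset ι) (v : ι → Matrix (Fin n) (Fin n) E) :
    mnorm n (∑ i ∈ s, v i) ≤ ∑ i ∈ s, mnorm n (v i) := by
  classical
  induction s using Finset.induction_on with
  | empty => simp [mnorm_zero]
  | insert i s hi ih =>
    rw [Finset.sum_insert hi, Finset.sum_insert hi]
    exact (QuantumSpace.mnorm_add_le n _ _).trans (by gcongr)

theorem mnorm_sandwich_le {m : ℕ} (α : Matrix (Fin n) (Fin m) ℂ) (v : Matrix (Fin m) (Fin m) E)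
    (β : Matrix (Fin m) (Fin n) ℂ) : mnorm n (sandwich α v β) ≤ ‖α‖ * mnorm m v * ‖β‖ :=
  QuantumSpace.mnorm_mul_mul_le m n α v β

theorem mnorm_blockSum {m : ℕ} (v : Matrix (Fin m) (Fin m) E) (w : Matrix (Fin n) (Fin n) E) :
    mnorm (m + n) (blockSum v w) = max (mnorm m v) (mnorm n w) :=
  QuantumSpace.mnorm_directSum m n v w

theorem norm_single_le {m : ℕ} (i : Fin m) (j : Fin n) :
    ‖(Matrix.single i j 1 : Matrix (Fin m) (Fin n) ℂ)‖ ≤ 1 := by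
  apply NuclearSpace.opNorm_le_of_sq _ _ zero_le_one
  intro x
  have : ∀ k, ((Matrix.single i j 1 : Matrix (Fin m) (Fin n) ℂ).mulVec x) k =
      if k = i then x j else 0 := fun k => by
    by_cases h : k = i
    · subst h
      simp [Matrix.mulVec, dotProduct, Matrix.single_apply]
    · simp [Matrix.mulVec, dotProduct, h, Ne.symm h]
  simp only [this, apply_ite norm, norm_zero, ite_pow, one_pow, one_mul]
  simp only [ne_eq, OfNat.ofNat_ne_zero, not_false_eq_true, zero_pow, Finset.sum_ite_eq',
    Finset.mem_univ, if_true]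
  exact Finset.single_le_sum (f := fun j => ‖x j‖ ^ 2) (fun _ _ => by positivity)
    (Finset.mem_univ j)

/-- An entry is a two-sided product of `v` with contractive matrix units. -/
theorem norm_apply_le_mnorm (v : Matrix (Fin n) (Fin n) E) (i j : Fin n) : ‖v i j‖ ≤ mnorm n v := by
  have h := mnorm_sandwich_le (Matrix.single 0 i 1 : Matrix (Fin 1) (Fin n) ℂ) v (Matrix.single j 0 1)
  rw [QuantumSpace.mnorm_one, sandwich_apply] at h
  have e : ∑ k, ∑ l, ((Matrix.single 0 i 1 : Matrix (Fin 1) (Fin n) ℂ) 0 k *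
      (Matrix.single j 0 1 : Matrix (Fin n) (Fin 1) ℂ) l 0) • v k l = v i j := by
    simp [Matrix.single_apply]
  rw [e] at h
  refine h.trans ?_
  have h1 := norm_single_le (0 : Fin 1) i
  have h2 := norm_single_le j (0 : Fin 1)
  have h3 := mnorm_nonneg v
  calc _ ≤ 1 * mnorm n v * 1 := by gcongr
    _ = _ := by ring

/-- Each entry is put in its place by matrix units. This crude bound is what keeps the supremum
defining the coproduct norm finite. -/
theorem mnorm_le_sum (v : Matrix (Fin n) (Fin n) E) : mnorm n v ≤ ∑ i, ∑ j, ‖v i j‖ := by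
  have h : v = ∑ i, ∑ j, sandwich (Matrix.single i 0 1 : Matrix (Fin n) (Fin 1) ℂ)
      (Matrix.of fun _ _ => v i j) (Matrix.single (0 : Fin 1) j 1) := by
    ext k l
    simp [sandwich_apply, Matrix.sum_apply, Matrix.single_apply, ite_and]
  conv_lhs => rw [h]
  refine (mnorm_sum_le _ _).trans (Finset.sum_le_sum fun i _ => (mnorm_sum_le _ _).trans
    (Finset.sum_le_sum fun j _ => ?_))
  refine (mnorm_sandwich_le _ _ _).trans ?_
  rw [QuantumSpace.mnorm_one]
  have h1 := norm_single_le i (0 : Fin 1)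
  have h2 := norm_single_le (0 : Fin 1) j
  calc _ ≤ 1 * ‖v i j‖ * 1 := by gcongr; exact le_rfl
    _ = _ := by ring

end

theorem mnorm_map_le_cbNorm {φ : E →ₗ[ℂ] F} (hφ : IsCompletelyBounded φ) {n : ℕ}
    (v : Matrix (Fin n) (Fin n) E) : mnorm n (v.map φ) ≤ cbNorm φ * mnorm n v := by
  rcases (mnorm_nonneg v).eq_or_lt with h | h
  · rw [QuantumSpace.eq_zero_of_mnorm_eq_zero n v h.symm, Matrix.map_zero _ (map_zero φ),
      mnorm_zero, mnorm_zero, mul_zero]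
  · have hc : ‖((mnorm n v : ℂ))⁻¹‖ = (mnorm n v)⁻¹ := by
      rw [norm_inv, Complex.norm_real, Real.norm_of_nonneg h.le]
    have h1 : mnorm n (((mnorm n v : ℂ)⁻¹ • v).map φ) ≤ cbNorm φ := by
      obtain ⟨C, hC⟩ := hφ
      -- The constant in `IsCompletelyBounded` carries no sign condition.
      refine le_csSup ⟨max C 0, ?_⟩ ⟨n, _, ?_, rfl⟩
      · rintro r ⟨k, w, hw, rfl⟩
        refine (hC k w).trans ?_
        calc C * mnorm k w ≤ max C 0 * mnorm k w :=
              mul_le_mul_of_nonneg_right (le_max_left _ _) (mnorm_nonneg _)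
          _ ≤ max C 0 := mul_le_of_le_one_right (le_max_right _ _) hw
      · rw [QuantumSpace.mnorm_smul, hc, inv_mul_cancel₀ h.ne']
    rw [Matrix.map_smul φ _ (map_smul φ _), QuantumSpace.mnorm_smul, hc,
      inv_mul_le_iff₀ h] at h1
    linarith

theorem cbNorm_le {φ : E →ₗ[ℂ] F} {C : ℝ} (hC : 0 ≤ C)
    (h : ∀ (n : ℕ) (v : Matrix (Fin n) (Fin n) E), mnorm n (v.map φ) ≤ C * mnorm n v) :
    cbNorm φ ≤ C := by
  refine csSup_le ⟨_, 0, 0, by rw [mnorm_zero]; exact zero_le_one, rfl⟩ ?_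
  rintro r ⟨n, v, hv, rfl⟩
  exact (h n v).trans (mul_le_of_le_one_right hC hv)

theorem cbNorm_nonneg (φ : E →ₗ[ℂ] F) : 0 ≤ cbNorm φ := by
  apply Real.sSup_nonneg
  rintro r ⟨n, v, -, rfl⟩
  exact mnorm_nonneg _

theorem IsCompletelyContractive.cbNorm_le {φ : E →ₗ[ℂ] F} (h : IsCompletelyContractive φ) :
    cbNorm φ ≤ 1 :=
  _root_.cbNorm_le zero_le_one fun n v => by rw [one_mul]; exact h n v

theorem IsCompletelyContractive.norm_le {φ : E →ₗ[ℂ] F} (h : IsCompletelyContractive φ) (x : E) :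
    ‖φ x‖ ≤ ‖x‖ := by
  have := h 1 (Matrix.of fun _ _ => x)
  rwa [QuantumSpace.mnorm_one, QuantumSpace.mnorm_one] at this

theorem IsCompletelyCoisometric.isCompletelyContractive {τ : E →ₗ[ℂ] F}
    (h : IsCompletelyCoisometric τ) : IsCompletelyContractive τ := by
  intro n v
  refine le_of_forall_gt_imp_ge_of_dense fun c hc => ?_
  have hc0 : 0 < c := (mnorm_nonneg v).trans_lt hc
  have hn : ‖(c : ℂ)⁻¹‖ = c⁻¹ := by
    rw [norm_inv, Complex.norm_real, Real.norm_of_nonneg hc0.le]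
  have h1 : ((c : ℂ)⁻¹ • v).map τ ∈ {w : Matrix (Fin n) (Fin n) F | mnorm n w < 1} := by
    rw [← h n]
    refine ⟨_, ?_, rfl⟩
    change mnorm n _ < 1
    rw [QuantumSpace.mnorm_smul, hn, inv_mul_lt_iff₀ hc0, mul_one]
    exact hc
  rw [Set.mem_ofPred_eq, Matrix.map_smul τ _ (map_smul τ _), QuantumSpace.mnorm_smul, hn,
    inv_mul_lt_iff₀ hc0, mul_one] at h1
  exact h1.le

theorem IsCompletelyCoisometric.exists_lift {τ : E →ₗ[ℂ] F} (h : IsCompletelyCoisometric τ)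
    {n : ℕ} {w : Matrix (Fin n) (Fin n) F} {C : ℝ} (hw : mnorm n w < C) :
    ∃ v : Matrix (Fin n) (Fin n) E, v.map τ = w ∧ mnorm n v < C := by
  have hc0 : 0 < C := (mnorm_nonneg w).trans_lt hw
  have hc' : (C : ℂ) ≠ 0 := by exact_mod_cast hc0.ne'
  have hn : ‖(C : ℂ)‖ = C := by rw [Complex.norm_real, Real.norm_of_nonneg hc0.le]
  have h1 : (C : ℂ)⁻¹ • w ∈ {w : Matrix (Fin n) (Fin n) F | mnorm n w < 1} := by
    rw [Set.mem_ofPred_eq, QuantumSpace.mnorm_smul, norm_inv, hn, inv_mul_lt_iff₀ hc0, mul_one]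
    exact hw
  rw [← h n] at h1
  obtain ⟨v, hv, hvw⟩ := h1
  refine ⟨(C : ℂ) • v, ?_, ?_⟩
  · rw [Matrix.map_smul τ _ (map_smul τ _)]
    dsimp only at hvw
    rw [hvw, smul_smul, mul_inv_cancel₀ hc', one_smul]
  · rw [QuantumSpace.mnorm_smul, hn]
    exact (mul_lt_iff_lt_one_right hc0).2 hv

end QuantumBasics

/-! ## Matrix-valued complete contractions separate matrix norms -/

section MatrixFunctionals

open scoped Matrix.Norms.L2Operator
open QuantumSpace (mnorm)

/-- A convex cone of pairs `(w, c)` with `c ≤ p w` is dominated by a linear functional `f ≤ p`. -/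
theorem exists_linear_ge_of_cone {W : Type*} [AddCommGroup W] [Module ℝ W] (p : Seminorm ℝ W)
    (C : Set (W × ℝ)) (h0 : 0 ∈ C) (hadd : ∀ x ∈ C, ∀ y ∈ C, x + y ∈ C)
    (hsmul : ∀ t : ℝ, 0 < t → ∀ x ∈ C, t • x ∈ C) (hp : ∀ x ∈ C, x.2 ≤ p x.1) :
    ∃ f : W →ₗ[ℝ] ℝ, (∀ w, f w ≤ p w) ∧ ∀ x ∈ C, x.2 ≤ f x.1 := by
  -- This sublinear function encodes both demands on `f`. If `f ≤ N`, then the point `0` of the cone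
  -- gives `f ≤ p`, and evaluating at `-x.1` gives `f (-x.1) ≤ p 0 - x.2 = -x.2`.
  let N : W → ℝ := fun w => ⨅ x : C, (p (w + x.1.1) - x.1.2)
  have hbdd : ∀ w, BddBelow (Set.range fun x : C => p (w + x.1.1) - x.1.2) := fun w => by
    refine ⟨-p w, ?_⟩
    rintro _ ⟨x, rfl⟩
    have h1 := hp x.1 x.2
    have h2 := map_add_le_add p (w + x.1.1) (-w)
    rw [add_neg_cancel_comm, map_neg_eq_map] at h2
    dsimp only
    linarith
  have hne : Nonempty C := ⟨⟨0, h0⟩⟩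
  have hle : ∀ w, ∀ x ∈ C, N w ≤ p (w + x.1) - x.2 := fun w x hx => ciInf_le (hbdd w) ⟨x, hx⟩
  have hNsmul : ∀ t : ℝ, 0 < t → ∀ w, N (t • w) ≤ t * N w := by
    intro t ht w
    rw [Real.mul_iInf_of_nonneg ht.le]
    refine le_ciInf fun x => ?_
    refine (hle _ _ (hsmul t ht x.1 x.2)).trans_eq ?_
    rw [Prod.smul_fst, Prod.smul_snd, ← smul_add, map_smul_eq_mul, Real.norm_of_nonneg ht.le,
      smul_eq_mul, mul_sub]
  have key : ∃ f : W →ₗ[ℝ] ℝ, ∀ w, f w ≤ N w := by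
    -- Hahn–Banach starts from the zero functional on the zero subspace; `0 ≤ N 0` is exactly the
    -- hypothesis on the cone.
    refine (exists_extension_of_le_sublinear ⟨⊥, 0⟩ N ?_ ?_ ?_).imp fun f hf => hf.2
    · intro t ht w
      refine le_antisymm (hNsmul t ht w) ?_
      have := hNsmul t⁻¹ (inv_pos.2 ht) (t • w)
      rwa [smul_smul, inv_mul_cancel₀ ht.ne', one_smul, le_inv_mul_iff₀ ht] at this
    · intro w w'
      refine le_of_forall_pos_le_add fun ε hε => ?_
      obtain ⟨x, hx⟩ := exists_lt_of_ciInf_lt (lt_add_of_pos_right (N w) (half_pos hε))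
      obtain ⟨y, hy⟩ := exists_lt_of_ciInf_lt (lt_add_of_pos_right (N w') (half_pos hε))
      have h1 := hle (w + w') _ (hadd x.1 x.2 y.1 y.2)
      have h2 := map_add_le_add p (w + x.1.1) (w' + y.1.1)
      rw [Prod.fst_add, Prod.snd_add, add_add_add_comm] at h1
      linarith
    · rintro ⟨w, hw⟩
      have h : w = 0 := hw
      subst h
      change (0 : ℝ) ≤ _
      refine le_ciInf fun x => ?_
      rw [zero_add]
      exact sub_nonneg.2 (hp x.1 x.2)
  obtain ⟨f, hf⟩ := key
  refine ⟨f, fun w => ?_, fun x hx => ?_⟩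
  · simpa using (hf w).trans (hle w 0 h0)
  · have := (hf (-x.1)).trans (hle (-x.1) x hx)
    rw [neg_add_cancel, map_zero, map_neg] at this
    linarith

/-- The square of the Hilbert–Schmidt norm. -/
noncomputable def sqSum {m n : Type*} [Fintype m] [Fintype n] (X : Matrix m n ℂ) : ℝ :=
  ∑ i, ∑ j, ‖X i j‖ ^ 2

theorem sqSum_nonneg {m n : Type*} [Fintype m] [Fintype n] (X : Matrix m n ℂ) : 0 ≤ sqSum X :=
  Finset.sum_nonneg fun _ _ => Finset.sum_nonneg fun _ _ => by positivity

theorem sqSum_conjTranspose {m n : Type*} [Fintype m] [Fintype n] (X : Matrix m n ℂ) :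
    sqSum X.conjTranspose = sqSum X := by
  rw [sqSum, sqSum, Finset.sum_comm]
  simp

open scoped ComplexOrder MatrixOrder in
/-- A positive functional on matrices is dominated by `X ↦ tr (Cᴴ C X)` with `C` invertible, up to
an arbitrarily small error. -/
theorem exists_factor_of_positive {m : ℕ} (f : Matrix (Fin m) (Fin m) ℂ →ₗ[ℝ] ℝ)
    (hf : ∀ ξ : Fin m → ℂ, 0 ≤ f (Matrix.vecMulVec ξ (star ξ))) {δ : ℝ} (hδ : 0 < δ) :
    ∃ C : Matrix (Fin m) (Fin m) ℂ, IsUnit C ∧ ∀ (n : ℕ) (α : Matrix (Fin m) (Fin n) ℂ),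
      sqSum (C * α) = f (α * α.conjTranspose) + δ * sqSum α := by
  let h : Matrix (Fin m) (Fin m) ℂ →ₗ[ℂ] ℂ := Module.Dual.extendRCLike f
  have hre : ∀ X, (h X).re = f X := fun X => by
    exact Module.Dual.re_extendRCLike_apply (𝕜 := ℂ) f X
  -- The density matrix of `h`: the transposed indices give `h X = tr (R X)`.
  let R : Matrix (Fin m) (Fin m) ℂ := Matrix.of fun i j => h (Matrix.single j i 1)
  have hR : ∀ ξ : Fin m → ℂ, star ξ ⬝ᵥ R.mulVec ξ = h (Matrix.vecMulVec ξ (star ξ)) := by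
    intro ξ
    conv_rhs => rw [Matrix.matrix_eq_sum_single (Matrix.vecMulVec ξ (star ξ))]
    have : ∀ i j, h (Matrix.single i j (Matrix.vecMulVec ξ (star ξ) i j)) =
        ξ i * star (ξ j) * R j i := fun i j => by
      rw [← mul_one (Matrix.vecMulVec ξ (star ξ) i j), ← smul_eq_mul, ← Matrix.smul_single,
        map_smul]
      rfl
    simp only [map_sum, this, dotProduct, Matrix.mulVec, Finset.mul_sum]
    rw [Finset.sum_comm]
    refine Finset.sum_congr rfl fun i _ => Finset.sum_congr rfl fun j _ => ?_
    simp only [Pi.star_apply]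
    ring
  -- The Hermitian part of `R` has quadratic form `Re h = f` on rank-one projections up to scale;
  -- the summand `δ` makes the form positive definite, so that its factor `C` is invertible.
  let P : Matrix (Fin m) (Fin m) ℂ := (1 / 2 : ℂ) • (R + R.conjTranspose) + (δ : ℂ) • 1
  have hP : ∀ ξ : Fin m → ℂ, star ξ ⬝ᵥ P.mulVec ξ =
      ((f (Matrix.vecMulVec ξ (star ξ)) + δ * ∑ i, ‖ξ i‖ ^ 2 : ℝ) : ℂ) := by
    intro ξ
    have h1 : star ξ ⬝ᵥ R.conjTranspose.mulVec ξ = star (h (Matrix.vecMulVec ξ (star ξ))) := by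
      rw [← hR, Matrix.star_dotProduct, Matrix.star_mulVec, Matrix.dotProduct_mulVec]
      simp
    have h2 : star ξ ⬝ᵥ ξ = ((∑ i, ‖ξ i‖ ^ 2 : ℝ) : ℂ) := by
      simp only [dotProduct, Pi.star_apply, Complex.ofReal_sum]
      refine Finset.sum_congr rfl fun i _ => ?_
      rw [Complex.star_def, Complex.conj_mul']
      push_cast
      rfl
    simp only [P, Matrix.add_mulVec, Matrix.smul_mulVec, dotProduct_add, dotProduct_smul,
      Matrix.one_mulVec, h1, h2, hR]
    rw [Complex.star_def, Complex.add_conj, hre]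
    simp only [smul_eq_mul]
    push_cast
    ring
  have hPH : P.IsHermitian := by
    rw [Matrix.IsHermitian]
    simp [P, Matrix.conjTranspose_add, Matrix.conjTranspose_smul, add_comm]
  have hpos : P.PosDef := by
    refine Matrix.PosDef.of_dotProduct_mulVec_pos hPH fun ξ hξ => ?_
    rw [hP]
    have : 0 < ∑ i, ‖ξ i‖ ^ 2 := by
      obtain ⟨i, hi⟩ := Function.ne_iff.1 hξ
      exact Finset.sum_pos' (fun _ _ => by positivity)
        ⟨i, Finset.mem_univ i, pow_pos (norm_pos_iff.2 hi) 2⟩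
    have h3 := hf ξ
    exact_mod_cast add_pos_of_nonneg_of_pos h3 (mul_pos hδ this)
  obtain ⟨C, hC⟩ := CStarAlgebra.nonneg_iff_eq_star_mul_self.1 hpos.posSemidef.nonneg
  rw [Matrix.star_eq_conjTranspose] at hC
  have hvec : ∀ ξ : Fin m → ℂ, ∑ i, ‖(C.mulVec ξ) i‖ ^ 2 =
      f (Matrix.vecMulVec ξ (star ξ)) + δ * ∑ i, ‖ξ i‖ ^ 2 := by
    intro ξ
    have h1 := hP ξ
    rw [hC, ← Matrix.mulVec_mulVec, Matrix.dotProduct_mulVec, ← Matrix.star_mulVec] at h1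
    have h2 : star (C.mulVec ξ) ⬝ᵥ C.mulVec ξ = ((∑ i, ‖(C.mulVec ξ) i‖ ^ 2 : ℝ) : ℂ) := by
      simp only [dotProduct, Pi.star_apply, Complex.ofReal_sum]
      refine Finset.sum_congr rfl fun i _ => ?_
      rw [Complex.star_def, Complex.conj_mul']
      push_cast
      rfl
    rw [h2] at h1
    exact_mod_cast h1
  refine ⟨C, ?_, fun n α => ?_⟩
  · have h1 := hpos.isUnit
    rw [hC] at h1
    rw [Matrix.isUnit_iff_isUnit_det] at h1 ⊢
    rw [Matrix.det_mul] at h1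
    exact isUnit_of_mul_isUnit_right h1
  · have h1 : α * α.conjTranspose = ∑ k, Matrix.vecMulVec (α.col k) (star (α.col k)) := by
      ext i j
      simp [Matrix.mul_apply, Matrix.sum_apply, Matrix.vecMulVec_apply]
    rw [h1, map_sum, sqSum, sqSum, Finset.sum_comm, Finset.sum_comm (f := fun i j => ‖α i j‖ ^ 2),
      Finset.mul_sum, ← Finset.sum_add_distrib]
    exact Finset.sum_congr rfl fun k _ => hvec (α.col k)

/-- Taking for `ξ` the conjugate of `T η` turns the hypothesis into `2‖Tη‖² ≤ ‖Tη‖² + ‖η‖²`. -/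
theorem norm_le_one_of_bilinear {p : Type*} [Fintype p] [DecidableEq p] (T : Matrix p p ℂ)
    (h : ∀ ξ η : p → ℂ, 2 * (ξ ⬝ᵥ T.mulVec η).re ≤ ∑ i, ‖ξ i‖ ^ 2 + ∑ i, ‖η i‖ ^ 2) : ‖T‖ ≤ 1 := by
  apply NuclearSpace.opNorm_le_of_sq _ _ zero_le_one
  intro η
  have h1 := h (star (T.mulVec η)) η
  have h2 : star (T.mulVec η) ⬝ᵥ T.mulVec η = ((∑ i, ‖(T.mulVec η) i‖ ^ 2 : ℝ) : ℂ) := by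
    simp only [dotProduct, Pi.star_apply, Complex.ofReal_sum]
    refine Finset.sum_congr rfl fun i _ => ?_
    rw [Complex.star_def, Complex.conj_mul']
    push_cast
    rfl
  rw [h2, Complex.ofReal_re] at h1
  simp only [Pi.star_apply, norm_star] at h1
  linarith

theorem norm_bilinear_le {p : Type*} [Fintype p] [DecidableEq p] (T : Matrix p p ℂ) (ξ η : p → ℂ) :
    ‖ξ ⬝ᵥ T.mulVec η‖ ≤ ‖T‖ * (√(∑ i, ‖ξ i‖ ^ 2) * √(∑ i, ‖η i‖ ^ 2)) := by
  have h1 : ‖ξ ⬝ᵥ T.mulVec η‖ ≤ √(∑ i, ‖ξ i‖ ^ 2) * √(∑ i, ‖(T.mulVec η) i‖ ^ 2) := by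
    refine (norm_sum_le _ _).trans ?_
    simp only [norm_mul]
    exact Real.sum_mul_le_sqrt_mul_sqrt _ _ _
  have h2 : √(∑ i, ‖(T.mulVec η) i‖ ^ 2) ≤ ‖T‖ * √(∑ i, ‖η i‖ ^ 2) := by
    rw [← Real.sqrt_sq (norm_nonneg T), ← Real.sqrt_mul (sq_nonneg _)]
    exact Real.sqrt_le_sqrt (NuclearSpace.sq_mulVec_le T η)
  calc _ ≤ √(∑ i, ‖ξ i‖ ^ 2) * (‖T‖ * √(∑ i, ‖η i‖ ^ 2)) :=
        h1.trans (mul_le_mul_of_nonneg_left h2 (Real.sqrt_nonneg _))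
    _ = _ := by ring

/-- The block matrix obtained by applying a matrix-valued operator to the entries of a matrix. -/
def blockMap {H : Type*} [AddCommGroup H] [Module ℂ H] {n m : Type*}
    (g : H →ₗ[ℂ] Matrix m m ℂ) :
    Matrix n n H →ₗ[ℂ] Matrix (n × m) (n × m) ℂ where
  toFun v := Matrix.of fun p q => g (v p.1 q.1) p.2 q.2
  map_add' v w := by ext; simp
  map_smul' c v := by ext; simp

theorem blockMap_apply {H : Type*} [AddCommGroup H] [Module ℂ H] {n m : Type*} (g : H →ₗ[ℂ] Matrix m m ℂ)
    (v : Matrix n n H) (p q : n × m) :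
    blockMap g v p q = g (v p.1 q.1) p.2 q.2 := rfl

variable {G : Type*} [NormedAddCommGroup G] [NormedSpace ℂ G] [QuantumSpace G]

/-- The norms of matrix spaces are bare functions. Hahn–Banach is therefore applied with a normed
structure local to the proof, and the result is stated for plain linear maps. -/
theorem exists_functional_of_core {V : Type*} [AddCommGroup V] [Module ℂ V] [Norm V]
    (core : NormedSpace.Core ℂ V) {z : V} (hz : ‖z‖ ≠ 0) :
    ∃ F : V →ₗ[ℂ] ℂ, (∀ y, ‖F y‖ ≤ ‖y‖) ∧ ‖F z‖ = ‖z‖ := by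
  let _ : NormedAddCommGroup V := NormedAddCommGroup.ofCore core
  let _ : NormedSpace ℂ V := NormedSpace.ofCore core
  obtain ⟨g, hg, hgz⟩ := exists_dual_vector ℂ z hz
  refine ⟨g.toLinearMap, fun y => ?_, ?_⟩
  · have := g.le_opNorm y
    rwa [hg, one_mul] at this
  · change ‖g z‖ = ‖z‖
    rw [hgz]
    exact (Complex.norm_real ‖z‖).trans (norm_norm z)

theorem exists_functional_mnorm {m : ℕ} (z : Matrix (Fin m) (Fin m) G) :
    ∃ F : Matrix (Fin m) (Fin m) G →ₗ[ℂ] ℂ, (∀ y, ‖F y‖ ≤ mnorm m y) ∧ ‖F z‖ = mnorm m z := by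
  rcases eq_or_ne z 0 with rfl | hz
  · exact ⟨0, fun y => by simpa using mnorm_nonneg y, by simp [mnorm_zero]⟩
  let _ : Norm (Matrix (Fin m) (Fin m) G) := ⟨mnorm m⟩
  refine exists_functional_of_core
    { norm_nonneg := mnorm_nonneg
      norm_smul := QuantumSpace.mnorm_smul m
      norm_triangle := QuantumSpace.mnorm_add_le m
      norm_eq_zero_iff := fun v => ⟨QuantumSpace.eq_zero_of_mnorm_eq_zero m v,
        fun h => h ▸ mnorm_zero⟩ } fun h => hz (QuantumSpace.eq_zero_of_mnorm_eq_zero m z h)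

/-- A functional on `M_m(G)` is dominated by positive functionals evaluated on the outer factors of
a product `α v β`. -/
theorem exists_positive_dominating {m : ℕ} (F : Matrix (Fin m) (Fin m) G →ₗ[ℂ] ℂ)
    (hF : ∀ y, ‖F y‖ ≤ mnorm m y) :
    ∃ f₁ f₂ : Matrix (Fin m) (Fin m) ℂ →ₗ[ℝ] ℝ, f₁ 1 ≤ 1 ∧ f₂ 1 ≤ 1 ∧
      ∀ (n : ℕ) (α : Matrix (Fin m) (Fin n) ℂ) (v : Matrix (Fin n) (Fin n) G)
        (β : Matrix (Fin n) (Fin m) ℂ), mnorm n v ≤ 1 →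
        2 * (F (sandwich α v β)).re ≤ f₁ (α * α.conjTranspose) + f₂ (β.conjTranspose * β) := by
  let M := Matrix (Fin m) (Fin m) ℂ
  let p : Seminorm ℝ (M × M) := (normSeminorm ℝ M).comp (LinearMap.fst ℝ M M) +
    (normSeminorm ℝ M).comp (LinearMap.snd ℝ M M)
  have hp : ∀ x y, p (x, y) = ‖x‖ + ‖y‖ := fun x y => rfl
  -- The size `n` is unrestricted: block sums add two elements of the cone, and scaling both outer
  -- factors by `√t` multiplies an element by `t`.
  let C : Set ((M × M) × ℝ) := {x | ∃ (n : ℕ) (α : Matrix (Fin m) (Fin n) ℂ)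
    (v : Matrix (Fin n) (Fin n) G) (β : Matrix (Fin n) (Fin m) ℂ), mnorm n v ≤ 1 ∧
    x = ((α * α.conjTranspose, β.conjTranspose * β), 2 * (F (sandwich α v β)).re)}
  have key : ∃ f : M × M →ₗ[ℝ] ℝ, (∀ w, f w ≤ p w) ∧ ∀ x ∈ C, x.2 ≤ f x.1 := by
    refine exists_linear_ge_of_cone p C ?_ ?_ ?_ ?_
    · exact ⟨0, 0, 0, 0, by rw [mnorm_zero]; exact zero_le_one, by
        rw [sandwich_zero]; simp; rfl⟩
    · rintro _ ⟨n, α, v, β, hv, rfl⟩ _ ⟨n', α', v', β', hv', rfl⟩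
      refine ⟨n + n', (Matrix.fromCols α α').submatrix id finSumFinEquiv.symm, blockSum v v',
        (Matrix.fromRows β β').submatrix finSumFinEquiv.symm id, ?_, ?_⟩
      · rw [mnorm_blockSum]
        exact max_le hv hv'
      rw [sandwich_blockSum]
      refine Prod.ext (Prod.ext ?_ ?_) ?_
      · ext i j
        simp [Matrix.mul_apply, Fin.sum_univ_add]
      · ext i j
        simp [Matrix.mul_apply, Fin.sum_univ_add]
      · simp [mul_add]
    · rintro t ht _ ⟨n, α, v, β, hv, rfl⟩
      have hs : (√t : ℂ) * √t = (t : ℂ) := by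
        rw [← Complex.ofReal_mul, Real.mul_self_sqrt ht.le]
      refine ⟨n, (√t : ℂ) • α, v, (√t : ℂ) • β, hv, ?_⟩
      rw [smul_sandwich, sandwich_smul_right, smul_smul, hs, map_smul]
      refine Prod.ext (Prod.ext ?_ ?_) ?_
      · simp [Matrix.conjTranspose_smul, smul_smul, Real.mul_self_sqrt ht.le]
      · simp [Matrix.conjTranspose_smul, smul_smul, Real.mul_self_sqrt ht.le]
      · simp
        ring
    · rintro _ ⟨n, α, v, β, hv, rfl⟩
      rw [hp]
      -- Domination on the cone is the inequality `2‖α‖‖β‖ ≤ ‖α‖² + ‖β‖²` combined with the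
      -- C*-identity.
      have h1 : (F (sandwich α v β)).re ≤ ‖α‖ * ‖β‖ := by
        refine (Complex.re_le_norm _).trans ((hF _).trans ((mnorm_sandwich_le _ _ _).trans ?_))
        calc _ ≤ ‖α‖ * 1 * ‖β‖ := by gcongr
          _ = _ := by ring
      have h2 : ‖α * α.conjTranspose‖ = ‖α‖ * ‖α‖ := by
        have := Matrix.l2_opNorm_conjTranspose_mul_self α.conjTranspose
        rwa [Matrix.conjTranspose_conjTranspose, Matrix.l2_opNorm_conjTranspose] at this
      rw [h2, Matrix.l2_opNorm_conjTranspose_mul_self]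
      dsimp only
      nlinarith [sq_nonneg (‖α‖ - ‖β‖)]
  obtain ⟨f, hfp, hfC⟩ := key
  have h1 : ‖(1 : M)‖ ≤ 1 := by
    apply NuclearSpace.opNorm_le_of_sq _ _ zero_le_one
    intro x
    simp
  refine ⟨f ∘ₗ LinearMap.inl ℝ M M, f ∘ₗ LinearMap.inr ℝ M M, ?_, ?_, fun n α v β hv => ?_⟩
  · exact (hfp (1, 0)).trans (by rw [hp, norm_zero, add_zero]; exact h1)
  · exact (hfp (0, 1)).trans (by rw [hp, norm_zero, zero_add]; exact h1)
  · refine (hfC _ ⟨n, α, v, β, hv, rfl⟩).trans_eq ?_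
    rw [LinearMap.comp_apply, LinearMap.comp_apply]
    refine Eq.trans (congrArg f ?_) (map_add f _ _)
    exact Prod.ext (add_zero _).symm (zero_add _).symm

theorem norm_le_mnorm_of_le_one {p : Type*} [Fintype p] [DecidableEq p] {n : ℕ}
    (T : Matrix (Fin n) (Fin n) G →ₗ[ℂ] Matrix p p ℂ) (hT : ∀ v, mnorm n v ≤ 1 → ‖T v‖ ≤ 1)
    (v : Matrix (Fin n) (Fin n) G) : ‖T v‖ ≤ mnorm n v := by
  rcases (mnorm_nonneg v).eq_or_lt with h | h
  · rw [QuantumSpace.eq_zero_of_mnorm_eq_zero n v h.symm, map_zero, norm_zero, mnorm_zero]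
  · have hc : ‖((mnorm n v : ℂ))⁻¹‖ = (mnorm n v)⁻¹ := by
      rw [norm_inv, Complex.norm_real, Real.norm_of_nonneg h.le]
    have h1 := hT ((mnorm n v : ℂ)⁻¹ • v)
      (by rw [QuantumSpace.mnorm_smul, hc, inv_mul_cancel₀ h.ne'])
    rwa [map_smul, norm_smul, hc, inv_mul_le_iff₀ h, mul_one] at h1

/-- Ruan's lemma: matrix norms of a quantum space are determined by complete contractions into
matrix algebras. -/
theorem exists_blockMap_norm_ge {m : ℕ} (z : Matrix (Fin m) (Fin m) G) {ε : ℝ} (hε : 0 < ε) :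
    ∃ g : G →ₗ[ℂ] Matrix (Fin m) (Fin m) ℂ,
      (∀ (n : ℕ) (v : Matrix (Fin n) (Fin n) G), ‖blockMap g v‖ ≤ mnorm n v) ∧
      mnorm m z ≤ (1 + ε) * ‖blockMap g z‖ := by
  obtain ⟨F, hF, hFz⟩ := exists_functional_mnorm z
  obtain ⟨f₁, f₂, hf₁, hf₂, hf⟩ := exists_positive_dominating F hF
  -- Positivity comes from the domination itself, with `v = 0`, the column `ξ` as one factor and `0`
  -- as the other.
  have hpos₁ : ∀ ξ : Fin m → ℂ, 0 ≤ f₁ (Matrix.vecMulVec ξ (star ξ)) := fun ξ => by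
    have := hf 1 (Matrix.of fun i _ => ξ i) 0 0 (by rw [mnorm_zero]; exact zero_le_one)
    rw [sandwich_zero, map_zero, Complex.zero_re, mul_zero, Matrix.mul_zero, map_zero, add_zero] at this
    convert this using 2
    ext i j
    simp [Matrix.mul_apply, Matrix.vecMulVec_apply]
  have hpos₂ : ∀ ξ : Fin m → ℂ, 0 ≤ f₂ (Matrix.vecMulVec ξ (star ξ)) := fun ξ => by
    have := hf 1 0 0 (Matrix.of fun _ i => star (ξ i)) (by rw [mnorm_zero]; exact zero_le_one)
    rw [sandwich_zero, map_zero, Complex.zero_re, mul_zero, Matrix.zero_mul, map_zero,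
      zero_add] at this
    convert this using 2
    ext i j
    simp [Matrix.mul_apply, Matrix.vecMulVec_apply]
  obtain ⟨δ, hδ, hδε⟩ : ∃ δ : ℝ, 0 < δ ∧ δ * sqSum (1 : Matrix (Fin m) (Fin m) ℂ) ≤ ε := by
    refine ⟨ε / (sqSum (1 : Matrix (Fin m) (Fin m) ℂ) + 1), ?_, ?_⟩
    · have := sqSum_nonneg (1 : Matrix (Fin m) (Fin m) ℂ)
      positivity
    · have := sqSum_nonneg (1 : Matrix (Fin m) (Fin m) ℂ)
      rw [div_mul_eq_mul_div, div_le_iff₀ (by positivity)]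
      nlinarith
  obtain ⟨C, hC, hCf⟩ := exists_factor_of_positive f₁ hpos₁ hδ
  obtain ⟨D', hD', hDf⟩ := exists_factor_of_positive f₂ hpos₂ hδ
  have hCdet := (Matrix.isUnit_iff_isUnit_det _).1 hC
  -- The second functional is evaluated at `β*β`, so its factor acts on the right of `β`, as an
  -- adjoint.
  set D := D'.conjTranspose with hD
  have hDdet : IsUnit D.det := by
    rw [hD, Matrix.det_conjTranspose]
    exact ((Matrix.isUnit_iff_isUnit_det _).1 hD').star
  have hC1 : sqSum C ≤ 1 + ε := by
    have := hCf m 1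
    rw [mul_one, Matrix.conjTranspose_one, mul_one] at this
    linarith
  have hD1 : sqSum D ≤ 1 + ε := by
    have := hDf m 1
    rw [mul_one, Matrix.conjTranspose_one, mul_one, ← sqSum_conjTranspose] at this
    linarith
  -- The functional `F` divided by `C` on the left and `D` on the right. By `hg` below, the bilinear
  -- form of `blockMap g v` at the vectors made from `a` and `b` is `F (C⁻¹ a v b D⁻¹)`.
  let g : G →ₗ[ℂ] Matrix (Fin m) (Fin m) ℂ :=
    { toFun := fun x => Matrix.of fun i j => F (sandwich C⁻¹ (Matrix.single i j x) D⁻¹)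
      map_add' := fun x y => by
        ext i j
        simp [Matrix.single_add, sandwich_add]
      map_smul' := fun c x => by
        ext i j
        simp [← Matrix.smul_single, sandwich_smul] }
  have hg : ∀ (n : ℕ) (a : Matrix (Fin m) (Fin n) ℂ) (v : Matrix (Fin n) (Fin n) G)
      (b : Matrix (Fin n) (Fin m) ℂ), (fun p : Fin n × Fin m => a p.2 p.1) ⬝ᵥ
        (blockMap g v).mulVec (fun q => b q.1 q.2) = F (sandwich (C⁻¹ * a) v (b * D⁻¹)) := by
    intro n a v b
    have h1 : sandwich (C⁻¹ * a) v (b * D⁻¹) =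
        ∑ p : Fin n × Fin m, ∑ q : Fin n × Fin m, (a p.2 p.1 * b q.1 q.2) •
          sandwich C⁻¹ (Matrix.single p.2 q.2 (v p.1 q.1)) D⁻¹ := by
      rw [← sandwich_sandwich]
      have h2 : sandwich a v b = ∑ p : Fin n × Fin m, ∑ q : Fin n × Fin m,
          (a p.2 p.1 * b q.1 q.2) • Matrix.single p.2 q.2 (v p.1 q.1) := by
        ext i j
        simp only [sandwich_apply, Fintype.sum_prod_type, Matrix.sum_apply, Matrix.smul_apply]
        refine Finset.sum_congr rfl fun k _ => ?_
        rw [Finset.sum_eq_single i]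
        · refine Finset.sum_congr rfl fun l _ => ?_
          rw [Finset.sum_eq_single j]
          · rw [Matrix.single_apply_same]
          · intro j' _ hj
            rw [Matrix.single_apply_of_ne _ _ _ _ _ (by simp [hj]), smul_zero]
          · simp
        · intro i' _ hi
          refine Finset.sum_eq_zero fun l _ => Finset.sum_eq_zero fun j' _ => ?_
          rw [Matrix.single_apply_of_ne _ _ _ _ _ (by simp [hi]), smul_zero]
        · simp
      rw [h2]
      let S : Matrix (Fin m) (Fin m) G →ₗ[ℂ] Matrix (Fin m) (Fin m) G :=
        { toFun := fun y => sandwich C⁻¹ y D⁻¹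
          map_add' := fun x y => sandwich_add _ _ _ _
          map_smul' := fun c x => sandwich_smul _ _ _ _ }
      change S _ = ∑ p : Fin n × Fin m, ∑ q : Fin n × Fin m, (a p.2 p.1 * b q.1 q.2) • S _
      simp only [map_sum, map_smul]
    rw [h1]
    simp only [map_sum, map_smul, dotProduct, Matrix.mulVec, Finset.mul_sum, blockMap_apply]
    refine Finset.sum_congr rfl fun p _ => Finset.sum_congr rfl fun q _ => ?_
    simp only [g, LinearMap.coe_mk, AddHom.coe_mk, Matrix.of_apply, smul_eq_mul]
    ring
  have hsq : ∀ (n : ℕ) (a : Matrix (Fin n) (Fin m) ℂ), ∑ p : Fin n × Fin m, ‖a p.1 p.2‖ ^ 2 =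
      sqSum a := fun n a => Fintype.sum_prod_type _
  have hsq' : ∀ (n : ℕ) (a : Matrix (Fin m) (Fin n) ℂ), ∑ p : Fin n × Fin m, ‖a p.2 p.1‖ ^ 2 =
      sqSum a := fun n a => Fintype.sum_prod_type_right _
  refine ⟨g, fun n => norm_le_mnorm_of_le_one (blockMap g) fun v hv => ?_, ?_⟩
  · refine norm_le_one_of_bilinear _ fun ξ η => ?_
    let a : Matrix (Fin m) (Fin n) ℂ := Matrix.of fun i k => ξ (k, i)
    let b : Matrix (Fin n) (Fin m) ℂ := Matrix.of fun l j => η (l, j)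
    have h1 := hg n a v b
    have h2 := hf n (C⁻¹ * a) v (b * D⁻¹) hv
    rw [← h1] at h2
    have h3 := hCf n (C⁻¹ * a)
    have h4 := hDf n (b * D⁻¹).conjTranspose
    rw [Matrix.mul_nonsing_inv_cancel_left _ _ hCdet] at h3
    rw [Matrix.conjTranspose_conjTranspose, ← sqSum_conjTranspose, Matrix.conjTranspose_mul,
      Matrix.conjTranspose_conjTranspose, ← hD, Matrix.nonsing_inv_mul_cancel_right _ _ hDdet] at h4
    have h5 := mul_nonneg hδ.le (sqSum_nonneg (C⁻¹ * a))
    have h6 := mul_nonneg hδ.le (sqSum_nonneg (b * D⁻¹).conjTranspose)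
    have h7 := hsq' n a
    have h8 := hsq n b
    refine h2.trans ?_
    change _ ≤ ∑ p : Fin n × Fin m, ‖a p.2 p.1‖ ^ 2 + ∑ p : Fin n × Fin m, ‖b p.1 p.2‖ ^ 2
    linarith
  · have h1 := hg m C z D
    rw [Matrix.nonsing_inv_mul _ hCdet, Matrix.mul_nonsing_inv _ hDdet, one_sandwich_one] at h1
    rw [← hFz, ← h1]
    refine (norm_bilinear_le _ _ _).trans ?_
    rw [hsq' m C, hsq m D, mul_comm]
    refine mul_le_mul_of_nonneg_right ?_ (norm_nonneg _)
    calc √(sqSum C) * √(sqSum D) ≤ √(1 + ε) * √(1 + ε) := by gcongr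
      _ = 1 + ε := Real.mul_self_sqrt (by positivity)

end MatrixFunctionals

/-! ## Operators on `𝒩_n` -/

namespace NuclearSpace

open scoped Matrix.Norms.L2Operator
open QuantumSpace (mnorm)

theorem norm_pairing_le {n m r : ℕ} (u : Matrix (Fin m) (Fin m) (Matrix (Fin n) (Fin n) ℂ))
    (a : Matrix (Fin r) (Fin r) (Matrix (Fin n) (Fin n) ℂ)) :
    ‖pairing u a‖ ≤ dualNorm u * ‖Matrix.comp _ _ _ _ _ a‖ := by
  have hsmul : ∀ c : ℂ, Matrix.comp _ _ _ _ _ (c • a) = c • Matrix.comp _ _ _ _ _ a :=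
    fun c => rfl
  have hpair : ∀ c : ℂ, pairing u (c • a) = c • pairing u a := fun c => by
    ext p q
    simp [pairing]
  refine le_of_forall_pos_le_add fun ε hε => ?_
  set s := ‖Matrix.comp _ _ _ _ _ a‖
  -- The norm `s` may vanish, so `a` is normalized by `s + δ`.
  set δ := ε / (dualNorm u + 1)
  have hu := dualNorm_nonneg u
  have hδ : 0 < δ := by positivity
  have hs : 0 < s + δ := by positivity
  have hn : ‖((s + δ : ℝ) : ℂ)⁻¹‖ = (s + δ)⁻¹ := by
    rw [norm_inv, Complex.norm_real, Real.norm_of_nonneg hs.le]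
  have h1 := le_dualNorm u (((s + δ : ℝ) : ℂ)⁻¹ • a) (by
    rw [hsmul, norm_smul, hn, inv_mul_le_iff₀ hs]
    linarith)
  rw [hpair, norm_smul, hn, inv_mul_le_iff₀ hs] at h1
  have h2 : δ * dualNorm u ≤ ε := by
    rw [div_mul_eq_mul_div, div_le_iff₀ (by positivity)]
    nlinarith
  linarith

variable {n : ℕ} {E : Type*} [NormedAddCommGroup E] [NormedSpace ℂ E]

theorem mnorm_eq_dualNorm {m : ℕ} (u : Matrix (Fin m) (Fin m) (NuclearSpace.{u} n)) :
    mnorm m u = dualNorm (u.map toMatrix) := rfl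

/-- The matrix over `𝒩_n` that represents the identity operator of `ℬ(ℂⁿ)`. -/
noncomputable def universalMatrix (n : ℕ) : Matrix (Fin n) (Fin n) (NuclearSpace.{u} n) :=
  Matrix.of fun i j => toMatrix.symm (Matrix.single j i 1)

/-- Pairing with matrix units returns the matrix `a` itself, with its two tensor factors
interchanged. -/
theorem mnorm_universalMatrix_le : mnorm n (universalMatrix.{u} n) ≤ 1 := by
  rw [mnorm_eq_dualNorm]
  refine dualNorm_le _ fun r a ha => ?_
  have h : pairing ((universalMatrix.{u} n).map toMatrix) a =
      (Matrix.comp _ _ _ _ _ a).submatrix Prod.swap Prod.swap := by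
    ext ⟨k, i⟩ ⟨l, j⟩
    simp [pairing, universalMatrix, Matrix.trace_single_mul]
  rw [h]
  exact (norm_submatrix_le _ Prod.swap_injective Prod.swap_injective).trans ha

/-- The operator `𝒩_n → E` that corresponds to a matrix in `M_n(E)`. -/
noncomputable def ofMatrix (w : Matrix (Fin n) (Fin n) E) : NuclearSpace.{u} n →ₗ[ℂ] E where
  toFun b := ∑ i, ∑ j, toMatrix b j i • w i j
  map_add' b b' := by simp [add_smul, Finset.sum_add_distrib]
  map_smul' c b := by simp [Finset.smul_sum, smul_smul]

theorem ofMatrix_apply (w : Matrix (Fin n) (Fin n) E) (b : NuclearSpace.{u} n) :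
    ofMatrix w b = ∑ i, ∑ j, toMatrix b j i • w i j := rfl

/-- With `ofMatrix_map`, this identifies operators `𝒩_n → E` with `M_n(E)` through the image of the
universal matrix. -/
theorem map_ofMatrix (w : Matrix (Fin n) (Fin n) E) :
    (universalMatrix.{u} n).map (ofMatrix w) = w := by
  ext i j
  simp [universalMatrix, ofMatrix_apply, Matrix.single_apply, ite_and]

theorem ofMatrix_map (φ : NuclearSpace.{u} n →ₗ[ℂ] E) :
    ofMatrix ((universalMatrix.{u} n).map φ) = φ := by
  ext b
  rw [ofMatrix_apply]
  have h : b = ∑ j, ∑ i, toMatrix b j i • toMatrix.symm (Matrix.single j i 1) := by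
    apply toMatrix.injective
    simp only [map_sum, map_smul, LinearEquiv.apply_symm_apply, Matrix.smul_single, smul_eq_mul,
      mul_one]
    exact Matrix.matrix_eq_sum_single _
  conv_rhs => rw [h]
  rw [Finset.sum_comm]
  simp [universalMatrix]

theorem comp_ofMatrix {F : Type*} [NormedAddCommGroup F] [NormedSpace ℂ F] (φ : E →ₗ[ℂ] F)
    (w : Matrix (Fin n) (Fin n) E) :
    φ ∘ₗ (ofMatrix w : NuclearSpace.{u} n →ₗ[ℂ] E) = ofMatrix (w.map φ) := by
  ext b
  simp [ofMatrix_apply]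

variable [QuantumSpace E]

/-- A complete contraction `g` into `M_m` that almost norms the left side carries `w` to a test
matrix `a` over `ℬ(ℂⁿ)` of norm at most `‖w‖`. The image of the left side under `g` is then the
pairing of `u` with `a`, which the dual norm controls. -/
theorem mnorm_map_ofMatrix_le (w : Matrix (Fin n) (Fin n) E) {m : ℕ}
    (u : Matrix (Fin m) (Fin m) (NuclearSpace.{u} n)) :
    mnorm m (u.map (ofMatrix w)) ≤ mnorm n w * mnorm m u := by
  have key : ∀ ε : ℝ, 0 < ε →
      mnorm m (u.map (ofMatrix w)) ≤ (1 + ε) * (mnorm n w * mnorm m u) := by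
    intro ε hε
    obtain ⟨g, hg, hgz⟩ := exists_blockMap_norm_ge (u.map (ofMatrix w)) hε
    refine hgz.trans (mul_le_mul_of_nonneg_left ?_ (by positivity))
    let a : Matrix (Fin m) (Fin m) (Matrix (Fin n) (Fin n) ℂ) :=
      Matrix.of fun p q => Matrix.of fun i j => g (w i j) p q
    have h1 : blockMap g (u.map (ofMatrix w)) = pairing (u.map toMatrix) a := by
      ext ⟨k, p⟩ ⟨l, q⟩
      simp only [blockMap_apply, Matrix.map_apply, ofMatrix_apply, map_sum, map_smul,
        Matrix.sum_apply, Matrix.smul_apply, pairing, Matrix.of_apply, Matrix.trace,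
        Matrix.diag_apply, Matrix.mul_apply, a, smul_eq_mul]
      rw [Finset.sum_comm]
    have h2 : ‖Matrix.comp _ _ _ _ _ a‖ ≤ mnorm n w := by
      have : Matrix.comp _ _ _ _ _ a = (blockMap g w).submatrix Prod.swap Prod.swap := by
        ext ⟨p, i⟩ ⟨q, j⟩
        rfl
      rw [this]
      exact (norm_submatrix_le _ Prod.swap_injective Prod.swap_injective).trans (hg n w)
    rw [h1, mul_comm, mnorm_eq_dualNorm]
    exact (norm_pairing_le _ _).trans (mul_le_mul_of_nonneg_left h2 (dualNorm_nonneg _))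
  refine le_of_forall_pos_le_add fun ε hε => ?_
  have h0 := mul_nonneg (mnorm_nonneg w) (mnorm_nonneg u)
  set c := mnorm n w * mnorm m u
  refine (key (ε / (c + 1)) (by positivity)).trans ?_
  have : ε / (c + 1) * c ≤ ε := by
    rw [div_mul_eq_mul_div, div_le_iff₀ (by positivity)]
    nlinarith
  linarith

/-- Lifting an operator on `𝒩_n` amounts to lifting a single matrix in `M_n(E)`, which complete
coisometry allows. -/
theorem exists_lift {G : Type*} [NormedAddCommGroup G] [NormedSpace ℂ G] [QuantumSpace G]
    {τ : G →ₗ[ℂ] E} (hτ : IsCompletelyCoisometric τ) {φ : NuclearSpace.{u} n →ₗ[ℂ] E} {c C : ℝ}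
    (hc : 0 ≤ c) (hcC : c < C)
    (hφ : ∀ (m : ℕ) (u : Matrix (Fin m) (Fin m) (NuclearSpace.{u} n)),
      mnorm m (u.map φ) ≤ c * mnorm m u) :
    ∃ ψ : NuclearSpace.{u} n →ₗ[ℂ] G, τ ∘ₗ ψ = φ ∧
      ∀ (m : ℕ) (u : Matrix (Fin m) (Fin m) (NuclearSpace.{u} n)),
        mnorm m (u.map ψ) ≤ C * mnorm m u := by
  have h1 : mnorm n ((universalMatrix.{u} n).map φ) < C :=
    ((hφ n _).trans (mul_le_of_le_one_right hc mnorm_universalMatrix_le)).trans_lt hcC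
  obtain ⟨v, hv, hvC⟩ := hτ.exists_lift h1
  refine ⟨ofMatrix v, ?_, fun m u => ?_⟩
  · rw [comp_ofMatrix, hv, ofMatrix_map]
  · exact (mnorm_map_ofMatrix_le v u).trans
      (mul_le_mul_of_nonneg_right hvC.le (mnorm_nonneg _))

end NuclearSpace

/-! ## Lifting along complete coisometries out of near-retracts of coproducts -/

section QuantumLifting

open QuantumSpace (mnorm)

variable {E F G : Type*} [NormedAddCommGroup E] [NormedSpace ℂ E] [QuantumSpace E]
  [NormedAddCommGroup F] [NormedSpace ℂ F] [QuantumSpace F]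
  [NormedAddCommGroup G] [NormedSpace ℂ G] [QuantumSpace G]

theorem mnorm_map_smul {E : Type*} [AddCommGroup E] [Module ℂ E] (c : ℂ) (φ : E →ₗ[ℂ] F) {n : ℕ}
    (v : Matrix (Fin n) (Fin n) E) :
    mnorm n (v.map (c • φ)) = ‖c‖ * mnorm n (v.map φ) :=
  QuantumSpace.mnorm_smul n c (v.map φ)

theorem IsCompletelyContractive.comp {ψ : F →ₗ[ℂ] G} {φ : E →ₗ[ℂ] F}
    (hψ : IsCompletelyContractive ψ) (hφ : IsCompletelyContractive φ) :
    IsCompletelyContractive (ψ ∘ₗ φ) := fun n v => by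
  rw [LinearMap.coe_comp, ← Matrix.map_map]
  exact (hψ n _).trans (hφ n v)

theorem isCompletelyContractive_inv_smul {φ : E →ₗ[ℂ] F} {C : ℝ} (hC : 0 < C)
    (h : ∀ (n : ℕ) (v : Matrix (Fin n) (Fin n) E), mnorm n (v.map φ) ≤ C * mnorm n v) :
    IsCompletelyContractive ((C : ℂ)⁻¹ • φ) := fun n v => by
  rw [mnorm_map_smul, norm_inv, Complex.norm_real, Real.norm_of_nonneg hC.le,
    inv_mul_le_iff₀ hC]
  exact h n v

variable {P U : Type*} [NormedAddCommGroup P] [NormedSpace ℂ P] [QuantumSpace P]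
  [NormedAddCommGroup U] [NormedSpace ℂ U] [QuantumSpace U]

/-- The argument for modules, with summands `𝒩_n` in place of generators. The universal property
concerns complete contractions only, so everything is divided by `C` before it is applied and
multiplied back afterwards. -/
theorem exists_lift_of_isQuantumNearRetract {Λ : Type*} {n : Λ → ℕ}
    {ι : ∀ l, NuclearSpace.{u} (n l) →ₗ[ℂ] U} (hι : ∀ l, IsCompletelyContractive (ι l))
    (hG : ∀ ψ : ∀ l, NuclearSpace.{u} (n l) →ₗ[ℂ] G, (∀ l, IsCompletelyContractive (ψ l)) →
      ∃ Ψ : U →ₗ[ℂ] G, IsCompletelyContractive Ψ ∧ ∀ l, Ψ ∘ₗ ι l = ψ l)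
    (hE : ∀ f g : U →ₗ[ℂ] E, IsCompletelyContractive f → IsCompletelyContractive g →
      (∀ l, f ∘ₗ ι l = g ∘ₗ ι l) → f = g)
    (hP : IsQuantumNearRetract P U) (τ : G →ₗ[ℂ] E) (hτ : IsCompletelyCoisometric τ)
    (φ : P →ₗ[ℂ] E) (hφ : IsCompletelyBounded φ) (ε : ℝ) (hε : 0 < ε) :
    ∃ ψ : P →ₗ[ℂ] G, IsCompletelyBounded ψ ∧ τ ∘ₗ ψ = φ ∧ cbNorm ψ < cbNorm φ + ε := by
  obtain ⟨σ, hσ, hζ⟩ := hP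
  have hφ0 := cbNorm_nonneg φ
  set C := cbNorm φ + ε / 2 with hCdef
  have hC : 0 < C := by positivity
  have hC' : (C : ℂ) ≠ 0 := by exact_mod_cast hC.ne'
  have hφσ : ∀ (m : ℕ) (v : Matrix (Fin m) (Fin m) U),
      mnorm m (v.map (φ ∘ₗ σ)) ≤ cbNorm φ * mnorm m v := fun m v => by
    rw [LinearMap.coe_comp, ← Matrix.map_map]
    exact (mnorm_map_le_cbNorm hφ _).trans (mul_le_mul_of_nonneg_left (hσ m v) hφ0)
  have h1 : ∀ l, ∃ ψ : NuclearSpace.{u} (n l) →ₗ[ℂ] G, τ ∘ₗ ψ = (φ ∘ₗ σ) ∘ₗ ι l ∧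
      ∀ (m : ℕ) (u : Matrix (Fin m) (Fin m) (NuclearSpace.{u} (n l))),
        mnorm m (u.map ψ) ≤ C * mnorm m u := fun l => by
    refine NuclearSpace.exists_lift hτ hφ0 (lt_add_of_pos_right _ (half_pos hε)) fun m u => ?_
    rw [LinearMap.coe_comp, ← Matrix.map_map]
    exact (hφσ m _).trans (mul_le_mul_of_nonneg_left (hι l m u) hφ0)
  choose ψ hψ hψC using h1
  obtain ⟨Ψ, hΨ, hΨι⟩ := hG (fun l => (C : ℂ)⁻¹ • ψ l)
    fun l => isCompletelyContractive_inv_smul hC (hψC l)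
  have h2 : τ ∘ₗ Ψ = (C : ℂ)⁻¹ • (φ ∘ₗ σ) := by
    refine hE _ _ (hτ.isCompletelyContractive.comp hΨ)
      (isCompletelyContractive_inv_smul hC fun m v => (hφσ m v).trans ?_) fun l => ?_
    · exact mul_le_mul_of_nonneg_right (le_add_of_nonneg_right (half_pos hε).le) (mnorm_nonneg v)
    · rw [LinearMap.comp_assoc, hΨι, LinearMap.comp_smul, hψ, LinearMap.smul_comp]
  obtain ⟨ζ, hζb, hζ1, hζ2⟩ := hζ (ε / 2 / C) (by positivity)
  have hb : ∀ (m : ℕ) (v : Matrix (Fin m) (Fin m) P),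
      mnorm m (v.map ((C : ℂ) • (Ψ ∘ₗ ζ))) ≤ C * cbNorm ζ * mnorm m v := fun m v => by
    rw [mnorm_map_smul, Complex.norm_real, Real.norm_of_nonneg hC.le, mul_assoc,
      LinearMap.coe_comp, ← Matrix.map_map]
    exact mul_le_mul_of_nonneg_left ((hΨ m _).trans (mnorm_map_le_cbNorm hζb v)) hC.le
  refine ⟨(C : ℂ) • (Ψ ∘ₗ ζ), ⟨_, hb⟩, ?_, ?_⟩
  · rw [LinearMap.comp_smul, ← LinearMap.comp_assoc, h2, LinearMap.smul_comp, smul_smul,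
      mul_inv_cancel₀ hC', one_smul, LinearMap.comp_assoc, hζ1, LinearMap.comp_id]
  · calc cbNorm ((C : ℂ) • (Ψ ∘ₗ ζ)) ≤ C * cbNorm ζ :=
          cbNorm_le (mul_nonneg hC.le (cbNorm_nonneg ζ)) hb
      _ < C * (1 + ε / 2 / C) := mul_lt_mul_of_pos_left hζ2 hC
      _ = cbNorm φ + ε := by
        rw [mul_add, mul_div_cancel₀ _ hC.ne', hCdef]
        ring

theorem isQuantumNearRetract_of_lift {σ : U →ₗ[ℂ] P} (hσ : IsCompletelyCoisometric σ)
    (h : ∀ ε : ℝ, 0 < ε → ∃ ψ : P →ₗ[ℂ] U, IsCompletelyBounded ψ ∧ σ ∘ₗ ψ = LinearMap.id ∧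
      cbNorm ψ < cbNorm (LinearMap.id : P →ₗ[ℂ] P) + ε) :
    IsQuantumNearRetract P U := by
  refine ⟨σ, hσ.isCompletelyContractive, fun ε hε => ?_⟩
  obtain ⟨ζ, h0, h1, h2⟩ := h ε hε
  have h3 : IsCompletelyContractive (LinearMap.id : P →ₗ[ℂ] P) := fun n v => by
    rw [LinearMap.id_coe, Matrix.map_id]
  have := h3.cbNorm_le
  exact ⟨ζ, h0, h1, by linarith⟩

open CategoryTheory Limits

theorem QNor₁.hom_ext {E F : QNor₁.{u}} {f g : E ⟶ F}
    (h : QNor₁.Hom.toLinearMap f = QNor₁.Hom.toLinearMap g) : f = g := by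
  have key : ∀ f g : QNor₁.Hom E F, f.toLinearMap = g.toLinearMap → f = g := by
    rintro ⟨f, _⟩ ⟨g, _⟩ h
    cases h
    rfl
  exact key f g h

/-- No model of the coproduct is needed: the universal property supplies existence into `G` and
uniqueness into `E`. -/
theorem QNor₁.isQuantumExtremelyProjective {Λ : Type u} {n : Λ → ℕ}
    {U : Cofan fun l => QNor₁.nuclear.{u} (n l)} (hU : IsColimit U) {P : Type u}
    [NormedAddCommGroup P] [NormedSpace ℂ P] [QuantumSpace P]
    (hP : IsQuantumNearRetract P U.pt.carrier) : IsQuantumExtremelyProjective P := by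
  intro G E _ _ _ _ _ _ τ hτ φ hφ ε hε
  refine exists_lift_of_isQuantumNearRetract (n := n)
    (ι := fun l => QNor₁.Hom.toLinearMap (U.inj l)) (fun l => (U.inj l).contractive)
    (fun ψ hψ => ?_) (fun f g hf hg h => ?_) hP τ hτ φ hφ ε hε
  · let ψ' : ∀ l, QNor₁.nuclear.{u} (n l) ⟶ QNor₁.of G := fun l => ⟨ψ l, hψ l⟩
    let d := Cofan.IsColimit.desc hU ψ'
    exact ⟨d.toLinearMap, d.contractive, fun l =>
      congrArg QNor₁.Hom.toLinearMap (Cofan.IsColimit.fac hU ψ' l)⟩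
  · let f' : U.pt ⟶ QNor₁.of E := ⟨f, hf⟩
    let g' : U.pt ⟶ QNor₁.of E := ⟨g, hg⟩
    have : f' = g' := Cofan.IsColimit.hom_ext hU _ _ fun l => QNor₁.hom_ext (h l)
    exact congrArg QNor₁.Hom.toLinearMap this

theorem QBan₁.isCompleteQuantumExtremelyProjective {Λ : Type u} {n : Λ → ℕ}
    {U : Cofan fun l => QBan₁.nuclear.{u} (n l)} (hU : IsColimit U) {P : Type u}
    [NormedAddCommGroup P] [NormedSpace ℂ P] [QuantumSpace P]
    (hP : IsQuantumNearRetract P U.pt.obj.carrier) : IsCompleteQuantumExtremelyProjective P := by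
  intro G E _ _ _ _ _ _ _ _ τ hτ φ hφ ε hε
  refine exists_lift_of_isQuantumNearRetract (n := n)
    (ι := fun l => QNor₁.Hom.toLinearMap (U.inj l).hom) (fun l => (U.inj l).hom.contractive)
    (fun ψ hψ => ?_) (fun f g hf hg h => ?_) hP τ hτ φ hφ ε hε
  · let G' : QBan₁.{u} := ⟨QNor₁.of G, inferInstanceAs (CompleteSpace G)⟩
    let ψ' : ∀ l, QBan₁.nuclear.{u} (n l) ⟶ G' := fun l => ObjectProperty.homMk ⟨ψ l, hψ l⟩
    let d := Cofan.IsColimit.desc hU ψ'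
    exact ⟨d.hom.toLinearMap, d.hom.contractive, fun l =>
      congrArg (fun k => QNor₁.Hom.toLinearMap (InducedCategory.Hom.hom k))
        (Cofan.IsColimit.fac hU ψ' l)⟩
  · let E' : QBan₁.{u} := ⟨QNor₁.of E, inferInstanceAs (CompleteSpace E)⟩
    let f' : U.pt ⟶ E' := ObjectProperty.homMk ⟨f, hf⟩
    let g' : U.pt ⟶ E' := ObjectProperty.homMk ⟨g, hg⟩
    have : f' = g' := Cofan.IsColimit.hom_ext hU _ _ fun l =>
      ObjectProperty.hom_ext _ (QNor₁.hom_ext (h l))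
    exact congrArg (fun k => QNor₁.Hom.toLinearMap (InducedCategory.Hom.hom k)) this

end QuantumLifting

/-! ## Coproducts of the spaces `𝒩_n` -/

section Coproducts

open scoped Matrix.Norms.L2Operator
open QuantumSpace (mnorm)

namespace NuclearSpace

/-- The unit of the one-dimensional space `𝒩_1`. -/
noncomputable def unit : NuclearSpace.{u} 1 := toMatrix.symm 1

theorem one_le_norm_unit : 1 ≤ ‖unit.{u}‖ := by
  let a : Matrix (Fin 1) (Fin 1) (Matrix (Fin 1) (Fin 1) ℂ) := 1
  have h1 : Matrix.comp _ _ _ _ _ a = 1 := by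
    ext ⟨i, j⟩ ⟨k, l⟩
    rw [Subsingleton.elim i 0, Subsingleton.elim j 0, Subsingleton.elim k 0, Subsingleton.elim l 0]
    rfl
  have h2 := le_dualNorm (Matrix.of fun _ _ : Fin 1 => toMatrix unit.{u}) a
    (by rw [h1, norm_one])
  have h3 : pairing (Matrix.of fun _ _ : Fin 1 => toMatrix unit.{u}) a = 1 := by
    ext ⟨i, j⟩ ⟨k, l⟩
    rw [Subsingleton.elim i 0, Subsingleton.elim j 0, Subsingleton.elim k 0, Subsingleton.elim l 0]
    simp [pairing, unit, a]
  rw [h3, norm_one] at h2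
  exact h2

open scoped Kronecker in
-- This lets `𝒩_1` stand for the scalars as a quantum space in the required universe, so that
-- completely contractive functionals can serve as tests.
theorem mnorm_smul_unit_le {m : ℕ} (A : Matrix (Fin m) (Fin m) ℂ) :
    mnorm m (A.map fun c => c • unit.{u}) ≤ ‖A‖ := by
  rw [mnorm_eq_dualNorm]
  refine dualNorm_le _ fun r a ha => ?_
  let b : Matrix (Fin r) (Fin r) ℂ := Matrix.of fun i j => a i j 0 0
  have h : pairing ((A.map fun c => c • unit.{u}).map toMatrix) a = A ⊗ₖ b := by
    ext ⟨i, j⟩ ⟨k, l⟩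
    simp [pairing, unit, b, Matrix.trace]
  have hb : ‖b‖ ≤ 1 := (norm_submatrix_le (Matrix.comp _ _ _ _ _ a) (f := fun i => (i, 0))
    (g := fun i => (i, 0)) (fun _ _ e => (Prod.ext_iff.1 e).1)
    (fun _ _ e => (Prod.ext_iff.1 e).1)).trans ha
  rw [h]
  exact (norm_kronecker_le _ _).trans (mul_le_of_le_one_right (norm_nonneg _) hb)

end NuclearSpace

/-- A quantum space has completely contractive functionals that almost attain the norm of a given
element. -/
theorem exists_functional_norm_le {E : Type*} [NormedAddCommGroup E] [NormedSpace ℂ E]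
    [QuantumSpace E] (x : E) {ε : ℝ} (hε : 0 < ε) :
    ∃ h : E →ₗ[ℂ] ℂ, (∀ (m : ℕ) (v : Matrix (Fin m) (Fin m) E),
      ‖(v.map h : Matrix (Fin m) (Fin m) ℂ)‖ ≤ mnorm m v) ∧
      ∃ r : ℝ, h x = r ∧ ‖x‖ ≤ (1 + ε) * r := by
  obtain ⟨g, hg, hgx⟩ := exists_blockMap_norm_ge (Matrix.of fun _ _ : Fin 1 => x) hε
  rw [QuantumSpace.mnorm_one, Matrix.of_apply] at hgx
  let h : E →ₗ[ℂ] ℂ := Matrix.entryLinearMap ℂ ℂ 0 0 ∘ₗ g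
  have hh : ∀ y, h y = g y 0 0 := fun y => rfl
  have hmap : ∀ (m : ℕ) (v : Matrix (Fin m) (Fin m) E),
      ‖(v.map h : Matrix (Fin m) (Fin m) ℂ)‖ ≤ mnorm m v := fun m v =>
    (NuclearSpace.norm_submatrix_le (blockMap g v) (f := fun i => (i, 0)) (g := fun i => (i, 0))
      (fun _ _ e => (Prod.ext_iff.1 e).1) (fun _ _ e => (Prod.ext_iff.1 e).1)).trans (hg m v)
  have hx : ‖blockMap g (Matrix.of fun _ _ : Fin 1 => x)‖ ≤ ‖h x‖ := by
    refine NuclearSpace.opNorm_le_of_sq _ _ (norm_nonneg _) fun y => ?_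
    simp [Fintype.sum_prod_type, Matrix.mulVec, dotProduct, blockMap_apply, hh, mul_pow]
  -- A phase makes the value at `x` a nonnegative real, so that functionals on different summands
  -- can later be added without cancellation.
  obtain ⟨c, hc, hch⟩ : ∃ c : ℂ, ‖c‖ = 1 ∧ c * h x = (‖h x‖ : ℂ) := by
    rcases eq_or_ne (h x) 0 with h0 | h0
    · exact ⟨1, norm_one, by simp [h0]⟩
    · have h0' : (‖h x‖ : ℂ) ≠ 0 := by exact_mod_cast (norm_pos_iff.2 h0).ne'
      refine ⟨‖h x‖ / h x, ?_, div_mul_cancel₀ _ h0⟩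
      rw [norm_div, Complex.norm_real, norm_norm, div_self (norm_pos_iff.2 h0).ne']
  refine ⟨c • h, fun m v => ?_, ‖h x‖, hch, hgx.trans (by gcongr)⟩
  have : (v.map (c • h : E →ₗ[ℂ] ℂ) : Matrix (Fin m) (Fin m) ℂ) = c • v.map h := rfl
  rw [this, norm_smul, hc, one_mul]
  exact hmap m v

namespace SumSpace

variable {Λ : Type u} {n : Λ → ℕ} {V : Type u} [NormedAddCommGroup V] [NormedSpace ℂ V]
  (S : SumSpace (fun l => NuclearSpace.{u} (n l)) V)

/-- The contractions of `V` into a quantum space that are completely contractive on summands. -/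
structure IsTest (E : Type u) [NormedAddCommGroup E] [NormedSpace ℂ E] [QuantumSpace E]
    (f : V →ₗ[ℂ] E) : Prop where
  norm_le : ∀ x, ‖f x‖ ≤ ‖x‖
  contractive : ∀ l, IsCompletelyContractive (f ∘ₗ S.single l)

/-- The values of the matrix norms of a matrix over `V` under contractions of `V` that are
completely contractive on summands. -/
def testValues {m : ℕ} (v : Matrix (Fin m) (Fin m) V) : Set ℝ :=
  {r | ∃ (E : Type u) (_ : NormedAddCommGroup E) (_ : NormedSpace ℂ E) (_ : QuantumSpace E)
    (f : V →ₗ[ℂ] E), S.IsTest E f ∧ mnorm m (v.map f) = r}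

/-- The largest matrix norm for which the summands are embedded completely contractively. -/
noncomputable def sumNorm {m : ℕ} (v : Matrix (Fin m) (Fin m) V) : ℝ := sSup (S.testValues v)

variable {m : ℕ}

variable {S} in
theorem IsTest.mnorm_le {E : Type u} [NormedAddCommGroup E] [NormedSpace ℂ E] [QuantumSpace E]
    {f : V →ₗ[ℂ] E} (hf : S.IsTest E f) (v : Matrix (Fin m) (Fin m) V) :
    mnorm m (v.map f) ≤ S.sumNorm v := by
  refine le_csSup ⟨∑ i, ∑ j, ‖v i j‖, ?_⟩ ⟨E, _, _, _, f, hf, rfl⟩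
  rintro r ⟨E, _, _, _, f, hf, rfl⟩
  exact (mnorm_le_sum _).trans (Finset.sum_le_sum fun i _ => Finset.sum_le_sum fun j _ =>
    hf.norm_le _)

theorem isTest_zero : S.IsTest (NuclearSpace.{u} 1) (0 : V →ₗ[ℂ] NuclearSpace.{u} 1) where
  norm_le x := by simp
  contractive l k v := by
    have : v.map ((0 : V →ₗ[ℂ] NuclearSpace.{u} 1) ∘ₗ S.single l) = 0 := by ext; simp
    rw [this, mnorm_zero]
    exact mnorm_nonneg v

theorem sumNorm_le (v : Matrix (Fin m) (Fin m) V) {c : ℝ}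
    (h : ∀ (E : Type u) [NormedAddCommGroup E] [NormedSpace ℂ E] [QuantumSpace E]
      (f : V →ₗ[ℂ] E), S.IsTest E f → mnorm m (v.map f) ≤ c) : S.sumNorm v ≤ c := by
  refine csSup_le ⟨_, NuclearSpace.{u} 1, _, _, _, _, S.isTest_zero, rfl⟩ ?_
  rintro r ⟨E, _, _, _, f, hf, rfl⟩
  exact h E f hf

theorem sumNorm_nonneg (v : Matrix (Fin m) (Fin m) V) : 0 ≤ S.sumNorm v :=
  (mnorm_nonneg _).trans (S.isTest_zero.mnorm_le v)

/-- Almost norming functionals on the components of `x`, with nonnegative values `r l` there, add up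
to one test whose value at `x` is `∑ r l` times the unit. Hence tests detect the whole `ℓ₁`-norm. -/
theorem exists_isTest_norm_le (x : V) {ε : ℝ} (hε : 0 < ε) :
    ∃ f : V →ₗ[ℂ] NuclearSpace.{u} 1, S.IsTest _ f ∧ ‖x‖ ≤ (1 + ε) * ‖f x‖ := by
  have h1 := fun l => exists_functional_norm_le (S.incl x l) hε
  choose h hh r hr hxr using h1
  let T : ∀ l, NuclearSpace.{u} (n l) →ₗ[ℂ] NuclearSpace.{u} 1 := fun l =>
    (h l).smulRight NuclearSpace.unit
  have hT : ∀ l, IsCompletelyContractive (T l) := fun l k v =>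
    (NuclearSpace.mnorm_smul_unit_le (v.map (h l))).trans (hh l k v)
  have hT1 : ∀ l y, ‖T l y‖ ≤ 1 * ‖y‖ := fun l y => by
    rw [one_mul]
    exact (hT l).norm_le y
  have hS : S.SummableIn (NuclearSpace.{u} 1) := S.summableIn_of_complete
  refine ⟨S.sumMap hS T 1 hT1, ⟨fun y => ?_, fun l => ?_⟩, ?_⟩
  · simpa using norm_sumMap_le hS T 1 hT1 y
  · have : S.sumMap hS T 1 hT1 ∘ₗ S.single l = T l :=
      LinearMap.ext fun y => sumMap_single hS T 1 hT1 l y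
    rw [this]
    exact hT l
  · have hr0 : ∀ l, 0 ≤ r l := fun l => by
      have := (norm_nonneg _).trans (hxr l)
      exact nonneg_of_mul_nonneg_right this (by positivity)
    have hrle : ∀ l, r l ≤ ‖S.incl x l‖ := fun l => by
      have h2 := (hT l).norm_le (S.incl x l)
      have h3 : T l (S.incl x l) = (r l : ℂ) • NuclearSpace.unit := by
        rw [← hr l]
        rfl
      rw [h3, norm_smul, Complex.norm_real, Real.norm_of_nonneg (hr0 l)] at h2
      exact (le_mul_of_one_le_right (hr0 l) NuclearSpace.one_le_norm_unit).trans h2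
    have hrs : Summable r := Summable.of_nonneg_of_le hr0 hrle (S.hasSum_norm x).summable
    have h4 : S.sumMap hS T 1 hT1 x = ((∑' l, r l : ℝ) : ℂ) • NuclearSpace.unit := by
      change ∑' l, h l (S.incl x l) • NuclearSpace.unit = _
      simp only [hr]
      rw [Complex.ofReal_tsum]
      exact (Complex.hasSum_ofReal.2 hrs.hasSum).summable.tsum_smul_const _
    rw [h4, norm_smul, Complex.norm_real, Real.norm_of_nonneg (tsum_nonneg hr0)]
    have h5 : ‖x‖ ≤ (1 + ε) * ∑' l, r l := by
      rw [← (S.hasSum_norm x).tsum_eq, ← tsum_mul_left]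
      exact (S.hasSum_norm x).summable.tsum_le_tsum hxr (hrs.mul_left _)
    refine h5.trans (mul_le_mul_of_nonneg_left ?_ (by positivity))
    exact le_mul_of_one_le_right (tsum_nonneg hr0) NuclearSpace.one_le_norm_unit

theorem norm_le_of_isTest {x : V} {c : ℝ} (hc : 0 ≤ c)
    (h : ∀ f : V →ₗ[ℂ] NuclearSpace.{u} 1, S.IsTest _ f → ‖f x‖ ≤ c) : ‖x‖ ≤ c := by
  refine le_of_forall_pos_le_add fun ε hε => ?_
  obtain ⟨f, hf, hx⟩ := S.exists_isTest_norm_le x (show 0 < ε / (c + 1) by positivity)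
  refine hx.trans ((mul_le_mul_of_nonneg_left (h f hf) (by positivity)).trans ?_)
  have : ε / (c + 1) * c ≤ ε := by
    rw [div_mul_eq_mul_div, div_le_iff₀ (by positivity)]
    nlinarith
  linarith

/-- The coproduct quantum structure on an `ℓ₁`-sum of spaces `𝒩_n`. -/
noncomputable abbrev quantumSpace : QuantumSpace V where
  mnorm _ v := S.sumNorm v
  mnorm_add_le _ v w := S.sumNorm_le _ fun E _ _ _ f hf => by
    rw [Matrix.map_add f (map_add f)]
    exact (QuantumSpace.mnorm_add_le _ _ _).trans (add_le_add (hf.mnorm_le v) (hf.mnorm_le w))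
  mnorm_smul k c v := by
    have key : ∀ (c : ℂ) (v : Matrix (Fin k) (Fin k) V), S.sumNorm (c • v) ≤ ‖c‖ * S.sumNorm v :=
      fun c v => S.sumNorm_le _ fun E _ _ _ f hf => by
        rw [Matrix.map_smul f c (map_smul f c), QuantumSpace.mnorm_smul]
        exact mul_le_mul_of_nonneg_left (hf.mnorm_le v) (norm_nonneg c)
    refine le_antisymm (key c v) ?_
    rcases eq_or_ne c 0 with rfl | hc
    · rw [norm_zero, zero_mul]
      exact S.sumNorm_nonneg _
    · have := key c⁻¹ (c • v)
      rwa [smul_smul, inv_mul_cancel₀ hc, one_smul, norm_inv,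
        le_inv_mul_iff₀ (norm_pos_iff.2 hc)] at this
  eq_zero_of_mnorm_eq_zero k v h := by
    ext i j
    refine norm_le_zero_iff.1 (S.norm_le_of_isTest le_rfl fun f hf => ?_)
    exact (norm_apply_le_mnorm (v.map f) i j).trans ((hf.mnorm_le v).trans h.le)
  -- One inequality holds because tests are contractive, the other because tests into `𝒩_1` recover
  -- the norm of `V`.
  mnorm_one v := by
    refine le_antisymm (S.sumNorm_le _ fun E _ _ _ f hf => ?_)
      (S.norm_le_of_isTest (S.sumNorm_nonneg v) fun f hf => ?_)
    · rw [QuantumSpace.mnorm_one]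
      exact hf.norm_le _
    · refine le_trans (le_of_eq ?_) (hf.mnorm_le v)
      rw [QuantumSpace.mnorm_one]
      rfl
  mnorm_directSum k k' v w := by
    change S.sumNorm (blockSum v w) = _
    have h : ∀ (E : Type u) [NormedAddCommGroup E] [NormedSpace ℂ E] [QuantumSpace E]
        (f : V →ₗ[ℂ] E), mnorm (k + k') ((blockSum v w).map f) =
          max (mnorm k (v.map f)) (mnorm k' (w.map f)) := fun E _ _ _ f => by
      rw [map_blockSum, mnorm_blockSum]
    refine le_antisymm (S.sumNorm_le _ fun E _ _ _ f hf => ?_)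
      (max_le (S.sumNorm_le _ fun E _ _ _ f hf => ?_) (S.sumNorm_le _ fun E _ _ _ f hf => ?_))
    · rw [h]
      exact max_le_max (hf.mnorm_le v) (hf.mnorm_le w)
    · exact (le_max_left _ _).trans ((h E f).symm.le.trans (hf.mnorm_le _))
    · exact (le_max_right _ _).trans ((h E f).symm.le.trans (hf.mnorm_le _))
  mnorm_mul_mul_le k k' α v β := by
    change S.sumNorm (sandwich α v β) ≤ _
    refine S.sumNorm_le _ fun E _ _ _ f hf => ?_
    rw [map_sandwich]
    refine (mnorm_sandwich_le _ _ _).trans ?_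
    gcongr
    exact hf.mnorm_le v

theorem single_contractive (l : Λ) :
    let _ := S.quantumSpace
    IsCompletelyContractive (S.single l) := fun k v =>
  S.sumNorm_le _ fun E _ _ _ f hf => by
    rw [Matrix.map_map]
    exact hf.contractive l k v

/-- The summed operator is itself one of the tests over which the coproduct norm is a supremum. -/
theorem sumMap_contractive {E : Type u} [NormedAddCommGroup E] [NormedSpace ℂ E] [QuantumSpace E]
    (hE : S.SummableIn E) (φ : ∀ l, NuclearSpace.{u} (n l) →ₗ[ℂ] E)
    (hφ : ∀ l, IsCompletelyContractive (φ l))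
    (hφ1 : ∀ l x, ‖φ l x‖ ≤ 1 * ‖x‖) :
    let _ := S.quantumSpace
    IsCompletelyContractive (S.sumMap hE φ 1 hφ1) := fun k v => by
  refine IsTest.mnorm_le (S := S) ⟨fun x => ?_, fun l => ?_⟩ v
  · simpa using norm_sumMap_le hE φ 1 hφ1 x
  · have : S.sumMap hE φ 1 hφ1 ∘ₗ S.single l = φ l :=
      LinearMap.ext fun y => sumMap_single hE φ 1 hφ1 l y
    rw [this]
    exact hφ l

end SumSpace

end Coproducts

/-! ### Universal property of the sums, and extremely projective quantum spaces -/

section QuantumMain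

open scoped Matrix.Norms.L2Operator
open QuantumSpace (mnorm)
open CategoryTheory Limits

theorem IsCompletelyContractive.norm_le_one_mul {E F : Type*} [NormedAddCommGroup E]
    [NormedSpace ℂ E] [QuantumSpace E] [NormedAddCommGroup F] [NormedSpace ℂ F] [QuantumSpace F]
    {φ : E →ₗ[ℂ] F} (h : IsCompletelyContractive φ) (x : E) : ‖φ x‖ ≤ 1 * ‖x‖ := by
  rw [one_mul]
  exact h.norm_le x

namespace SumSpace

variable {Λ : Type u} {n : Λ → ℕ} {V : Type u} [NormedAddCommGroup V] [NormedSpace ℂ V]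
  (S : SumSpace (fun l => NuclearSpace.{u} (n l)) V)

theorem ext_of_contractive {E : Type*} [NormedAddCommGroup E] [NormedSpace ℂ E] [QuantumSpace E]
    [QuantumSpace V] {f g : V →ₗ[ℂ] E} (hf : IsCompletelyContractive f)
    (hg : IsCompletelyContractive g) (h : ∀ l, f ∘ₗ S.single l = g ∘ₗ S.single l) : f = g :=
  S.ext_of_norm_le hf.norm_le_one_mul hg.norm_le_one_mul fun l x => LinearMap.congr_fun (h l) x

/-- The operator on the sum given by completely contractive operators on the summands. -/
noncomputable def desc {E : Type u} [NormedAddCommGroup E] [NormedSpace ℂ E] [QuantumSpace E]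
    (hE : S.SummableIn E) (φ : ∀ l, NuclearSpace.{u} (n l) →ₗ[ℂ] E)
    (hφ : ∀ l, IsCompletelyContractive (φ l)) : V →ₗ[ℂ] E :=
  S.sumMap hE φ 1 fun l => (hφ l).norm_le_one_mul

theorem desc_comp_single {E : Type u} [NormedAddCommGroup E] [NormedSpace ℂ E] [QuantumSpace E]
    (hE : S.SummableIn E) (φ : ∀ l, NuclearSpace.{u} (n l) →ₗ[ℂ] E)
    (hφ : ∀ l, IsCompletelyContractive (φ l)) (l : Λ) :
    S.desc hE φ hφ ∘ₗ S.single l = φ l :=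
  LinearMap.ext fun x => sumMap_single hE φ 1 (fun l => (hφ l).norm_le_one_mul) l x

theorem desc_contractive {E : Type u} [NormedAddCommGroup E] [NormedSpace ℂ E] [QuantumSpace E]
    (hE : S.SummableIn E) (φ : ∀ l, NuclearSpace.{u} (n l) →ₗ[ℂ] E)
    (hφ : ∀ l, IsCompletelyContractive (φ l)) :
    let _ := S.quantumSpace
    IsCompletelyContractive (S.desc hE φ hφ) :=
  S.sumMap_contractive hE φ hφ _

/-- The sum with its coproduct quantum structure. -/
noncomputable def object : QNor₁.{u} :=
  @QNor₁.of V _ _ S.quantumSpace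

/-- The embeddings of the summands. -/
noncomputable def inj (l : Λ) : QNor₁.nuclear.{u} (n l) ⟶ S.object :=
  ⟨S.single l, S.single_contractive l⟩

/-- The morphism out of the sum given by morphisms on the summands. -/
noncomputable def descHom {E : QNor₁.{u}} (hE : S.SummableIn E.carrier)
    (φ : ∀ l, QNor₁.nuclear.{u} (n l) ⟶ E) : S.object ⟶ E :=
  ⟨S.desc hE (fun l => QNor₁.Hom.toLinearMap (φ l)) fun l => (φ l).contractive,
    S.desc_contractive hE _ _⟩

theorem inj_descHom {E : QNor₁.{u}} (hE : S.SummableIn E.carrier)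
    (φ : ∀ l, QNor₁.nuclear.{u} (n l) ⟶ E) (l : Λ) : S.inj l ≫ S.descHom hE φ = φ l :=
  QNor₁.hom_ext (S.desc_comp_single hE _ (fun l => (φ l).contractive) l)

theorem hom_ext {E : QNor₁.{u}} {f g : S.object ⟶ E} (h : ∀ l, S.inj l ≫ f = S.inj l ≫ g) :
    f = g :=
  QNor₁.hom_ext (@ext_of_contractive _ _ _ _ _ S _ _ _ _ S.quantumSpace _ _ f.contractive
    g.contractive fun l => congrArg QNor₁.Hom.toLinearMap (h l))

/-- The cofan of the embeddings of summands in `QNor₁`. -/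
noncomputable def cofan : Cofan fun l => QNor₁.nuclear.{u} (n l) := Cofan.mk S.object S.inj

/-- The cofan of the embeddings of summands is a coproduct in `QNor₁`. -/
noncomputable def isColimitCofan
    (hS : ∀ (E : Type u) [NormedAddCommGroup E] [NormedSpace ℂ E], S.SummableIn E) :
    IsColimit S.cofan :=
  Cofan.IsColimit.mk _ (fun t => S.descHom (hS _) t.inj) (fun t => S.inj_descHom (hS _) t.inj)
    fun t _ hf => S.hom_ext fun l => (hf l).trans (S.inj_descHom (hS _) t.inj l).symm

/-- The cofan of the embeddings of summands in `QBan₁`. -/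
noncomputable def banachCofan [CompleteSpace V] : Cofan fun l => QBan₁.nuclear.{u} (n l) :=
  Cofan.mk ⟨S.object, inferInstanceAs (CompleteSpace V)⟩ fun l => ObjectProperty.homMk (S.inj l)

theorem summableIn_object (E : QBan₁.{u}) : S.SummableIn E.obj.carrier :=
  let _ : CompleteSpace E.obj.carrier := E.property
  S.summableIn_of_complete

/-- The cofan of the embeddings of summands is a coproduct in `QBan₁`. -/
noncomputable def isColimitBanachCofan [CompleteSpace V] : IsColimit S.banachCofan :=
  Cofan.IsColimit.mk _
    (fun t => ObjectProperty.homMk (S.descHom (S.summableIn_object t.pt) fun l => (t.inj l).hom))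
    (fun _ l => ObjectProperty.hom_ext _ (S.inj_descHom _ _ l))
    fun t _ hf => ObjectProperty.hom_ext _ (S.hom_ext fun l =>
      (congrArg (fun k => InducedCategory.Hom.hom k) (hf l)).trans
        (S.inj_descHom (S.summableIn_object t.pt) (fun l => (t.inj l).hom) l).symm)

end SumSpace

/-- The square matrices of positive size in the closed unit balls of a quantum space. -/
abbrev UnitMatrices (P : Type u) [NormedAddCommGroup P] [NormedSpace ℂ P] [QuantumSpace P] :
    Type u :=
  Σ n : ℕ+, {v : Matrix (Fin n) (Fin n) P // mnorm n v ≤ 1}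

theorem UnitMatrices.ofMatrix_contractive {P : Type u} [NormedAddCommGroup P] [NormedSpace ℂ P]
    [QuantumSpace P] (l : UnitMatrices P) :
    IsCompletelyContractive (NuclearSpace.ofMatrix l.2.1 : NuclearSpace.{u} l.1 →ₗ[ℂ] P) :=
  fun _ u => (NuclearSpace.mnorm_map_ofMatrix_le l.2.1 u).trans
    (mul_le_of_le_one_left (mnorm_nonneg u) l.2.2)

/-- Every quantum space is a completely coisometric image of a sum of spaces `𝒩_n`. -/
theorem exists_completelyCoisometric {P : Type u} [NormedAddCommGroup P] [NormedSpace ℂ P]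
    [QuantumSpace P] {V : Type u} [NormedAddCommGroup V] [NormedSpace ℂ V]
    (S : SumSpace (fun l : UnitMatrices P => NuclearSpace.{u} l.1) V) (hP : S.SummableIn P) :
    let _ := S.quantumSpace
    ∃ σ : V →ₗ[ℂ] P, IsCompletelyCoisometric σ := by
  intro _
  have hσ := S.desc_contractive hP _ UnitMatrices.ofMatrix_contractive
  refine ⟨S.desc hP _ UnitMatrices.ofMatrix_contractive,
    fun n => Set.Subset.antisymm ?_ fun z hz => ?_⟩
  · rintro _ ⟨v, hv, rfl⟩
    exact (hσ n v).trans_lt hv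
  -- The summands have positive size, so the trivial space `M_0(P)` is treated apart.
  · rcases Nat.eq_zero_or_pos n with rfl | hn
    · refine ⟨0, ?_, Subsingleton.elim _ _⟩
      change mnorm 0 (0 : Matrix (Fin 0) (Fin 0) V) < 1
      rw [mnorm_zero]
      exact zero_lt_one
    · obtain ⟨c, hc, hc1⟩ := exists_between (show mnorm n z < 1 from hz)
      have hc0 : 0 < c := (mnorm_nonneg z).trans_lt hc
      have hc' : (c : ℂ) ≠ 0 := by exact_mod_cast hc0.ne'
      have hnc : ‖(c : ℂ)‖ = c := by rw [Complex.norm_real, Real.norm_of_nonneg hc0.le]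
      let l : UnitMatrices P := ⟨⟨n, hn⟩, (c : ℂ)⁻¹ • z, by
        change mnorm n _ ≤ 1
        rw [QuantumSpace.mnorm_smul, norm_inv, hnc, inv_mul_le_iff₀ hc0, mul_one]
        exact hc.le⟩
      -- The summand indexed by `c⁻¹ • z` sends its universal matrix to `c⁻¹ • z`. Multiplying by `c
      -- < 1` gives a preimage of `z` in the open unit ball.
      refine ⟨(c : ℂ) • (NuclearSpace.universalMatrix.{u} n).map (S.single l), ?_, ?_⟩
      · change mnorm n _ < 1
        rw [QuantumSpace.mnorm_smul, hnc]
        refine (mul_le_of_le_one_right hc0.le ?_).trans_lt hc1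
        exact (S.single_contractive l n _).trans NuclearSpace.mnorm_universalMatrix_le
      · have key : ((NuclearSpace.universalMatrix.{u} l.1).map (S.single l)).map
            (S.desc hP _ UnitMatrices.ofMatrix_contractive) = l.2.1 := by
          rw [Matrix.map_map, ← LinearMap.coe_comp,
            S.desc_comp_single hP _ UnitMatrices.ofMatrix_contractive l,
            NuclearSpace.map_ofMatrix]
        refine (Matrix.map_smul _ _ (map_smul _ _) _).trans
          ((congrArg ((c : ℂ) • ·) key).trans ?_)
        change (c : ℂ) • (c : ℂ)⁻¹ • z = z
        rw [smul_smul, mul_inv_cancel₀ hc', one_smul]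

theorem isQuantumExtremelyProjective_iff (P : Type u) [NormedAddCommGroup P] [NormedSpace ℂ P]
    [QuantumSpace P] :
    IsQuantumExtremelyProjective P ↔
      ∃ (Λ : Type u) (n : Λ → ℕ+) (U : Cofan fun l => QNor₁.nuclear.{u} (n l)),
        Nonempty (IsColimit U) ∧ IsQuantumNearRetract P U.pt.carrier := by
  constructor
  · intro h
    -- Targets in `QNor₁` need not be complete, so only finite families can be summed there.
    let S := SumSpace.ofSubmodule (SumSpace.finiteFamilies fun l : UnitMatrices P => NuclearSpace.{u} l.1)
      SumSpace.single_mem_finiteFamilies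
    have hS : ∀ (E : Type u) [NormedAddCommGroup E] [NormedSpace ℂ E], S.SummableIn E :=
      fun E _ _ => S.summableIn_of_finite fun f => f.2
    let _ := S.quantumSpace
    obtain ⟨σ, hσ⟩ := exists_completelyCoisometric S (hS P)
    exact ⟨UnitMatrices P, Sigma.fst, S.cofan, ⟨S.isColimitCofan hS⟩,
      isQuantumNearRetract_of_lift hσ fun ε hε => h _ _ σ hσ _
        ⟨1, fun n v => by rw [LinearMap.id_coe, Matrix.map_id, one_mul]⟩ ε hε⟩
  · rintro ⟨Λ, n, U, ⟨hU⟩, hP⟩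
    exact QNor₁.isQuantumExtremelyProjective hU hP

theorem isCompleteQuantumExtremelyProjective_iff (P : Type u) [NormedAddCommGroup P]
    [NormedSpace ℂ P] [QuantumSpace P] [CompleteSpace P] :
    IsCompleteQuantumExtremelyProjective P ↔
      ∃ (Λ : Type u) (n : Λ → ℕ+) (U : Cofan fun l => QBan₁.nuclear.{u} (n l)),
        Nonempty (IsColimit U) ∧ IsQuantumNearRetract P U.pt.obj.carrier := by
  constructor
  · intro h
    -- The full `ℓ₁`-sum of the complete spaces `𝒩_n` is complete, hence an object of `QBan₁`.
    let S := SumSpace.lp fun l : UnitMatrices P => NuclearSpace.{u} l.1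
    let _ := S.quantumSpace
    obtain ⟨σ, hσ⟩ := exists_completelyCoisometric S S.summableIn_of_complete
    exact ⟨UnitMatrices P, Sigma.fst, S.banachCofan, ⟨S.isColimitBanachCofan⟩,
      isQuantumNearRetract_of_lift hσ fun ε hε => h _ _ σ hσ _
        ⟨1, fun n v => by rw [LinearMap.id_coe, Matrix.map_id, one_mul]⟩ ε hε⟩
  · rintro ⟨Λ, n, U, ⟨hU⟩, hP⟩
    exact QBan₁.isCompleteQuantumExtremelyProjective hU hP

end QuantumMain

theorem corollary6p13 :
    -- (i), normed modules over a normed algebra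
    (∀ (A : Type u) [NormedRing A] [NormedAlgebra ℂ A], ‖(1 : A)‖ ≤ 1 →
      ∀ (P : Type u) [NormedAddCommGroup P] [NormedSpace ℂ P] [Module A P] [IsScalarTower ℂ A P]
        [IsBoundedSMul A P],
        IsExtremelyProjective A P ↔
          ∃ M : Type u, IsNearRetract A P (ProjTensor A (L1Zero M))) ∧
    -- (i), Banach modules over a Banach algebra
    (∀ (A : Type u) [NormedRing A] [NormedAlgebra ℂ A] [CompleteSpace A], ‖(1 : A)‖ ≤ 1 →
      ∀ (P : Type u) [NormedAddCommGroup P] [NormedSpace ℂ P] [Module A P] [IsScalarTower ℂ A P]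
        [IsBoundedSMul A P] [CompleteSpace P],
        IsBanachExtremelyProjective A P ↔
          ∃ M : Type u, IsNearRetract A P (CompletedProjTensor A (L1 M))) ∧
    -- (ii), quantum spaces
    (∀ (P : Type u) [NormedAddCommGroup P] [NormedSpace ℂ P] [QuantumSpace P],
      IsQuantumExtremelyProjective P ↔
        ∃ (Λ : Type u) (n : Λ → ℕ+) (U : CategoryTheory.Limits.Cofan fun l => QNor₁.nuclear.{u} (n l)),
          Nonempty (CategoryTheory.Limits.IsColimit U) ∧ IsQuantumNearRetract P U.pt.carrier) ∧
    -- (ii), complete quantum spaces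
    (∀ (P : Type u) [NormedAddCommGroup P] [NormedSpace ℂ P] [QuantumSpace P] [CompleteSpace P],
      IsCompleteQuantumExtremelyProjective P ↔
        ∃ (Λ : Type u) (n : Λ → ℕ+) (U : CategoryTheory.Limits.Cofan fun l => QBan₁.nuclear.{u} (n l)),
          Nonempty (CategoryTheory.Limits.IsColimit U) ∧ IsQuantumNearRetract P U.pt.obj.carrier) := by
  exact ⟨fun A _ _ hA P => isExtremelyProjective_iff A hA P,
    fun A _ _ _ hA P => isBanachExtremelyProjective_iff A hA P,
    fun P => isQuantumExtremelyProjective_iff P,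
    fun P => isCompleteQuantumExtremelyProjective_iff P⟩
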